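/- Let $n\ge 1$, let $\mathbb{D}=\{z\in\mathbb{C}:|z|<1\}$, and let $H^2(\mathbb{D}^n)$ be the Hardy space on the polydisc, i.e. the Hilbert space of all holomorphic $f:\mathbb{D}^n\to\mathbb{C}$ with $$\|f\|=\Big(\sup_{0\le r<1}\int_{\mathbb{T}^n}|f(rz)|^2\,d\theta\Big)^{1/2}<\infty ,$$ where $d\theta$ is normalized Lebesgue measure on $\mathbb{T}^n$. For a bounded holomorphic function $\varphi$ on $\mathbb{D}^n$ let $M_\varphi$ be the operator $f\mapsto\varphi f$ on $H^2(\mathbb{D}^n)$, and write $P_{\mathcal M}$ for the orthogonal projection onto a closed subspace $\mathcal M$. A closed subspace $\mathcal{S}$ is a *submodule* if $M_{z_i}\mathcal{S}\subseteq\mathcal{S}$ for all $i=1,\dots,n$; a closed subspace $\mathcal{Q}$ is a *quotient module* if $\mathcal{Q}^\perp$ is a submodule, and it is *doubly commuting* if the compressions $C_{z_i}=P_{\mathcal Q}M_{z_i}|_{\mathcal Q}$ satisfy $C_{z_i}C_{z_j}^*=C_{z_j}^*C_{z_i}$ for all $1\le i<j\le n$. An *inner function* is a bounded holomorphic function on $\mathbb{D}$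 whose radial limits exist and have modulus $1$ at almost every point of the unit circle. Let $\mathcal{Q}\ne H^2(\mathbb{D}^n)$ be a doubly commuting quotient module of $H^2(\mathbb{D}^n)$. Then there exist an integer $m\in\{1,\dots,n\}$, indices $1\le i_1<\dots<i_m\le n$ and inner functions $\Theta_{i_1},\dots,\Theta_{i_m}$ such that, with $\tilde\Theta_{i_j}(z)=\Theta_{i_j}(z_{i_j})$ for $z\in\mathbb{D}^n$, the submodule $\mathcal{Q}^\perp$ is the (algebraic) sum $$\mathcal{Q}^\perp=\sum_{j=1}^m\tilde\Theta_{i_j}H^2(\mathbb{D}^n).$$ Moreover, for the same functions, the operators $I-M_{\tilde\Theta_{i_j}}M_{\tilde\Theta_{i_j}}^*$ $(1\le j\le m)$ commute with each other, and $$P_{\mathcal{Q}}=\prod_{j=1}^m\bigl(I-M_{\tilde\Theta_{i_j}}M_{\tilde\Theta_{i_j}}^*\bigr),\qquad P_{\mathcal{Q}^\perp}=I-\prod_{j=1}^m\bigl(I-M_{\tilde\Theta_{i_j}}M_{\tilde\Theta_{i_j}}^*\bigr).$$ -/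

import Mathlib

open MeasureTheory Set Filter Topology

namespace PolydiscHardy

/-! ### The polydisc and square means over tori -/

/-- The open unit polydisc `𝔻ⁿ`. -/
def polydisc (n : ℕ) : Set (Fin n → ℂ) := {z | ∀ i, ‖z i‖ < 1}

/-- Normalized Lebesgue (Haar) measure on the torus `𝕋ⁿ = (ℝ/ℤ)ⁿ`. -/
noncomputable def torusMeasure (n : ℕ) : Measure (Fin n → UnitAddCircle) :=
  Measure.pi fun _ => AddCircle.haarAddCircle

/-- The point `(r₁ e^{2πi t₁}, …, rₙ e^{2πi tₙ})`. -/
noncomputable def torusPoint {n : ℕ} (r : Fin n → ℝ) (t : Fin n → UnitAddCircle) : Fin n → ℂ :=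
  fun i => (r i : ℂ) * (AddCircle.toCircle (t i) : ℂ)

/-- The mean `∫_{𝕋ⁿ} |F(r z)|² dθ`. -/
noncomputable def meanSq {n : ℕ} (F : (Fin n → ℂ) → ℂ) (r : ℝ) : ℝ :=
  ∫ t, ‖F (torusPoint (fun _ => r) t)‖ ^ 2 ∂torusMeasure n

open Classical in
/-- Extension of a function on the polydisc by zero to all of `ℂⁿ`. -/
noncomputable def extendZero {n : ℕ} (f : polydisc n → ℂ) : (Fin n → ℂ) → ℂ :=
  fun z => if h : z ∈ polydisc n then f ⟨z, h⟩ else 0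

/-- Holomorphic functions on the open set `𝔻ⁿ`. -/
def IsHolomorphic {n : ℕ} (f : polydisc n → ℂ) : Prop :=
  DifferentiableOn ℂ (extendZero f) (polydisc n)

/-! ### Power series expansion on the polydisc, needed for the Hilbert space structure below -/

section PowerSeries

instance (n : ℕ) : IsProbabilityMeasure (torusMeasure n) := by
  unfold torusMeasure; infer_instance

instance (n : ℕ) : (torusMeasure n).IsAddHaarMeasure := by
  unfold torusMeasure; infer_instance

variable {n : ℕ}

lemma norm_toCircle (x : UnitAddCircle) : ‖(AddCircle.toCircle x : ℂ)‖ = 1 := Circle.norm_coe _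

lemma continuous_torusPoint (r : Fin n → ℝ) : Continuous (torusPoint r) := by
  unfold torusPoint
  refine continuous_pi fun i => continuous_const.mul ?_
  exact continuous_subtype_val.comp (AddCircle.continuous_toCircle.comp (continuous_apply i))

lemma norm_torusPoint (r : Fin n → ℝ) (t : Fin n → UnitAddCircle) (i : Fin n) :
    ‖torusPoint r t i‖ = |r i| := by
  simp [torusPoint, norm_toCircle]

lemma torusPoint_mem {r : Fin n → ℝ} (hr : ∀ i, r i ∈ Ico (0 : ℝ) 1)
    (t : Fin n → UnitAddCircle) : torusPoint r t ∈ polydisc n := fun i => by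
  rw [norm_torusPoint, abs_of_nonneg (hr i).1]; exact (hr i).2

lemma isOpen_polydisc (n : ℕ) : IsOpen (polydisc n) := by
  have : polydisc n = ⋂ i, {z : Fin n → ℂ | ‖z i‖ < 1} := by ext; simp [polydisc]
  rw [this]
  exact isOpen_iInter_of_finite fun i =>
    isOpen_lt (continuous_norm.comp (continuous_apply i)) continuous_const

lemma integral_fourier_mul (k : ℤ) (m : ℕ) :
    ∫ x : UnitAddCircle, fourier (-k) x * fourier (m : ℤ) x ∂AddCircle.haarAddCircle
      = if (m : ℤ) = k then 1 else 0 := by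
  have h := (orthonormal_iff_ite.mp (orthonormal_fourier (T := 1))) k m
  rw [ContinuousMap.inner_toLp] at h
  simp only [← fourier_neg, mul_comm (fourier (m : ℤ) _)] at h
  rw [h]; simp [eq_comm]

lemma oneVar (g : ℂ → ℂ) (hg : DifferentiableOn ℂ g (Metric.ball 0 1)) (k : ℤ) :
    ∃ B : ℂ, (k < 0 → B = 0) ∧ ∀ s ∈ Ico (0 : ℝ) 1,
      ∫ x : UnitAddCircle, fourier (-k) x * g (s * (AddCircle.toCircle x : ℂ))
        ∂AddCircle.haarAddCircle = B * (s : ℂ) ^ k.toNat := by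
  set a : ℕ → ℂ := fun m => ((m.factorial : ℂ))⁻¹ * iteratedDeriv m g 0 with ha
  have hsum : ∀ z ∈ Metric.ball (0 : ℂ) 1, HasSum (fun m => a m * z ^ m) (g z) := by
    intro z hz
    have := Complex.hasSum_taylorSeries_on_ball hg hz
    refine this.congr_fun ?_ 
    intro m; simp [ha]; ring
  refine ⟨if 0 ≤ k then a k.toNat else 0, fun hk => by simp [not_le.mpr hk], ?_⟩
  intro s hs
  have hpt : ∀ x : UnitAddCircle, (s * (AddCircle.toCircle x : ℂ)) ∈ Metric.ball (0 : ℂ) 1 := by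
    intro x; simp [abs_of_nonneg hs.1, hs.2, norm_toCircle]
  have hns : Summable fun m => ‖a m‖ * s ^ m := by
    have := (hsum (s : ℂ) (by simp [abs_of_nonneg hs.1, hs.2])).summable.norm
    simpa [abs_of_nonneg hs.1] using this
  have hF : ∀ x : UnitAddCircle, HasSum
      (fun m : ℕ => a m * s ^ m * (fourier (-k) x * fourier (m : ℤ) x))
      (fourier (-k) x * g (s * (AddCircle.toCircle x : ℂ))) := by
    intro x
    have := (hsum _ (hpt x)).mul_left (fourier (-k) x)
    refine this.congr_fun ?_
    intro m
    simp only [mul_pow, fourier_apply, AddCircle.toCircle_nsmul, natCast_zsmul, Circle.coe_pow]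
    ring
  have hint := hasSum_integral_of_summable_integral_norm
    (μ := (AddCircle.haarAddCircle : Measure UnitAddCircle))
    (F := fun (m : ℕ) (x : UnitAddCircle) =>
      a m * s ^ m * (fourier (-k) x * fourier (m : ℤ) x)) ?_ ?_
  · have e : ∀ x : UnitAddCircle, ∑' m : ℕ, a m * s ^ m * (fourier (-k) x * fourier (m : ℤ) x)
        = fourier (-k) x * g (s * (AddCircle.toCircle x : ℂ)) := fun x => (hF x).tsum_eq
    simp only [e, integral_const_mul, integral_fourier_mul] at hint
    refine hint.unique ?_
    by_cases hk : 0 ≤ k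
    · simp only [hk, if_true]
      have := hasSum_ite_eq k.toNat (a k.toNat * (s : ℂ) ^ k.toNat)
      refine this.congr_fun ?_
      intro m
      by_cases hm : m = k.toNat
      · simp [hm, hk]
      · have : (m : ℤ) ≠ k := by omega
        simp [hm, this]
    · have : ∀ m : ℕ, (m : ℤ) ≠ k := by intro m; omega
      simp [hk, this, hasSum_zero]
  · intro m
    refine Continuous.integrable_of_hasCompactSupport ?_ (HasCompactSupport.of_compactSpace _)
    fun_prop
  · refine hns.congr ?_
    intro m
    have : ∀ x : UnitAddCircle, ‖a m * s ^ m * (fourier (-k) x * fourier (m : ℤ) x)‖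
        = ‖a m‖ * s ^ m := by
      intro x
      simp [fourier_apply, abs_of_nonneg hs.1, norm_toCircle]
    simp only [this, integral_const]; simp

/-- Fourier coefficient on the torus of multiradius `r`. -/
noncomputable def torusCoeff (F : (Fin n → ℂ) → ℂ) (r : Fin n → ℝ) (k : Fin n → ℤ) : ℂ :=
  ∫ t, UnitAddTorus.mFourier (-k) t * F (torusPoint r t) ∂torusMeasure n

lemma continuous_comp_torus {F : (Fin n → ℂ) → ℂ} (hF : ContinuousOn F (polydisc n))
    {r : Fin n → ℝ} (hr : ∀ i, r i ∈ Ico (0 : ℝ) 1) : Continuous fun t => F (torusPoint r t) :=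
  hF.comp_continuous (continuous_torusPoint r) (torusPoint_mem hr)

lemma torusCoeff_update {F : (Fin n → ℂ) → ℂ} (hF : DifferentiableOn ℂ F (polydisc n))
    {r : Fin n → ℝ} (hr : ∀ i, r i ∈ Ico (0 : ℝ) 1) (i : Fin n) (k : Fin n → ℤ) :
    ∃ B : ℂ, (k i < 0 → B = 0) ∧ ∀ s ∈ Ico (0 : ℝ) 1,
      torusCoeff F (Function.update r i s) k = B * (s : ℂ) ^ (k i).toNat := by
  set g : (Fin n → UnitAddCircle) → ℂ → ℂ := fun t w =>
    F (Function.update (torusPoint r t) i (w * (AddCircle.toCircle (t i) : ℂ))) with hg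
  have hgd : ∀ t, DifferentiableOn ℂ (g t) (Metric.ball 0 1) := by
    intro t
    refine hF.comp (t := polydisc n) ?_ ?_
    · refine Differentiable.differentiableOn ?_
      refine differentiable_pi.mpr fun j => ?_
      by_cases hj : j = i
      · subst hj; simp only [Function.update_self]; fun_prop
      · simp only [Function.update_of_ne hj]; fun_prop
    · intro w hw j
      by_cases hj : j = i
      · subst hj; simpa [norm_toCircle] using hw
      · simpa [Function.update_of_ne hj] using torusPoint_mem hr t j
  choose B hB0 hB using fun t => oneVar (g t) (hgd t) (k i)
  refine ⟨∫ t, UnitAddTorus.mFourier (-k) t * B t ∂torusMeasure n, ?_, ?_⟩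
  · intro hk
    simp [hB0 _ hk]
  intro s hs
  have hus : ∀ j, Function.update r i s j ∈ Ico (0 : ℝ) 1 := by
    intro j
    by_cases hj : j = i
    · subst hj; simpa using hs
    · simpa [Function.update_of_ne hj] using hr j
  set H : (Fin n → UnitAddCircle) → ℂ := fun t =>
    UnitAddTorus.mFourier (-k) t * F (torusPoint (Function.update r i s) t) with hH
  have hHc : Continuous H := by
    have := continuous_comp_torus hF.continuousOn hus
    exact (ContinuousMap.continuous _).mul this
  have key : ∀ t x, H (t + Pi.single i x) = UnitAddTorus.mFourier (-k) t *
      (fourier (-(k i)) x * g t (s * (AddCircle.toCircle x : ℂ))) := by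
    intro t x
    have e1 : UnitAddTorus.mFourier (-k) (t + Pi.single i x)
        = UnitAddTorus.mFourier (-k) t * fourier (-(k i)) x := by
      simp only [UnitAddTorus.mFourier, ContinuousMap.coe_mk, Pi.add_apply, Pi.neg_apply]
      have : ∀ j, (fourier (-k j) (t j + (Pi.single i x : Fin n → UnitAddCircle) j) : ℂ)
          = fourier (-k j) (t j) * (if j = i then fourier (-(k i)) x else 1) := by
        intro j
        by_cases hj : j = i
        · subst hj; simp [fourier_apply, AddCircle.toCircle_add, smul_add]
        · simp [hj]
      rw [Finset.prod_congr rfl fun j _ => this j, Finset.prod_mul_distrib]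
      simp
    have e2 : torusPoint (Function.update r i s) (t + Pi.single i x)
        = Function.update (torusPoint r t) i
          (s * (AddCircle.toCircle x : ℂ) * (AddCircle.toCircle (t i) : ℂ)) := by
      ext j
      by_cases hj : j = i
      · subst hj; simp [torusPoint, AddCircle.toCircle_add]; ring
      · simp [torusPoint, hj]
    simp only [hH, e1, e2, hg, mul_assoc]
  have h1 : ∀ x : UnitAddCircle, ∫ t, H (t + Pi.single i x) ∂torusMeasure n
      = torusCoeff F (Function.update r i s) k := by
    intro x
    rw [integral_add_right_eq_self]
    rfl
  calc torusCoeff F (Function.update r i s) k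
      = ∫ x : UnitAddCircle, ∫ t, H (t + Pi.single i x) ∂torusMeasure n
          ∂AddCircle.haarAddCircle := by simp [h1]
    _ = ∫ t, ∫ x : UnitAddCircle, H (t + Pi.single i x) ∂AddCircle.haarAddCircle
          ∂torusMeasure n := by
        refine integral_integral_swap ?_
        refine Continuous.integrable_of_hasCompactSupport ?_ (HasCompactSupport.of_compactSpace _)
        refine hHc.comp (continuous_snd.add ?_)
        exact (continuous_single i).comp continuous_fst
    _ = ∫ t, UnitAddTorus.mFourier (-k) t * B t * (s : ℂ) ^ (k i).toNat ∂torusMeasure n := by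
        refine integral_congr_ae (Eventually.of_forall fun t => ?_)
        simp only [key, integral_const_mul]
        rw [hB t s hs]; ring
    _ = _ := by rw [integral_mul_const]


lemma torusCoeff_of_neg {F : (Fin n → ℂ) → ℂ} (hF : DifferentiableOn ℂ F (polydisc n))
    {r : Fin n → ℝ} (hr : ∀ i, r i ∈ Ico (0 : ℝ) 1) {i : Fin n} {k : Fin n → ℤ} (hk : k i < 0) :
    torusCoeff F r k = 0 := by
  obtain ⟨B, hB0, hB⟩ := torusCoeff_update hF hr i k
  have := hB (r i) (hr i)
  rwa [Function.update_eq_self, hB0 hk, zero_mul] at this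

/-- Inclusion of multi-indices `ℕⁿ → ℤⁿ`. -/
def natIdx (k : Fin n → ℕ) : Fin n → ℤ := fun i => (k i : ℤ)

lemma natIdx_injective : Function.Injective (natIdx (n := n)) := by
  intro k l h
  ext i
  simpa [natIdx] using congrFun h i

/-- The `k`-th Taylor coefficient at the origin (Cauchy's formula on a torus of radius `1/2`). -/
noncomputable def taylorCoeff (F : (Fin n → ℂ) → ℂ) (k : Fin n → ℕ) : ℂ :=
  torusCoeff F (fun _ => 1 / 2) (natIdx k) * ∏ i, (2 : ℂ) ^ k i

lemma torusCoeff_natIdx {F : (Fin n → ℂ) → ℂ} (hF : DifferentiableOn ℂ F (polydisc n))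
    {r : Fin n → ℝ} (hr : ∀ i, r i ∈ Ico (0 : ℝ) 1) (k : Fin n → ℕ) :
    torusCoeff F r (natIdx k) = taylorCoeff F k * ∏ i, (r i : ℂ) ^ k i := by
  classical
  have main : ∀ S : Finset (Fin n),
      torusCoeff F (fun i => if i ∈ S then r i else 1 / 2) (natIdx k)
        = taylorCoeff F k * ∏ i, (((if i ∈ S then r i else 1 / 2 : ℝ)) : ℂ) ^ k i := by
    intro S
    induction S using Finset.induction_on with
    | empty =>
      simp only [Finset.notMem_empty, if_false, taylorCoeff, mul_assoc, ← Finset.prod_mul_distrib,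
        ← mul_pow]
      simp
    | insert i S hi ih =>
      set r' : Fin n → ℝ := fun i => if i ∈ S then r i else 1 / 2 with hr'
      have hr'm : ∀ j, r' j ∈ Ico (0 : ℝ) 1 := by
        intro j; simp only [hr']; split_ifs
        · exact hr j
        · norm_num
      have e1 : (fun j => if j ∈ insert i S then r j else 1 / 2) = Function.update r' i (r i) := by
        ext j
        by_cases hj : j = i
        · subst hj; simp
        · simp [hr', hj]
      have e2 : Function.update r' i (1 / 2) = r' := by
        ext j
        by_cases hj : j = i
        · subst hj; simp [hr', hi]
        · simp [hj]
      have hp : ∀ s : ℝ, ∏ j, ((Function.update r' i s j : ℝ) : ℂ) ^ k j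
          = (s : ℂ) ^ k i * ∏ j ∈ Finset.univ.erase i, (r' j : ℂ) ^ k j := by
        intro s
        rw [← Finset.mul_prod_erase _ _ (Finset.mem_univ i)]
        congr 1
        · simp
        · refine Finset.prod_congr rfl fun j hj => ?_
          rw [Function.update_of_ne (Finset.ne_of_mem_erase hj)]
      have e3 : ∀ j, (if j ∈ insert i S then r j else 1 / 2) = Function.update r' i (r i) j :=
        fun j => congrFun e1 j
      obtain ⟨B, -, hB⟩ := torusCoeff_update hF hr'm i (natIdx k)
      have h1 := hB (1 / 2) (by norm_num)
      have h2 := hB (r i) (hr i)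
      rw [e2, ih] at h1
      have hp1 := hp (1 / 2)
      rw [e2] at hp1
      rw [hp1] at h1
      simp only [natIdx, Int.toNat_natCast] at h1 h2
      have h3 : taylorCoeff F k * ∏ j ∈ Finset.univ.erase i, (r' j : ℂ) ^ k j = B := by
        have : (((1 / 2 : ℝ) : ℂ) ^ k i) ≠ 0 := by
          apply pow_ne_zero; norm_num
        apply mul_right_cancel₀ this
        rw [← h1]; ring
      simp only [e3]
      change torusCoeff F (Function.update r' i (r i)) (natIdx k) = _
      rw [hp, h2, ← h3]; ring
  simpa using main Finset.univ

lemma summable_prod_pow : ∀ {n : ℕ} {x : Fin n → ℝ}, (∀ i, x i ∈ Ico (0 : ℝ) 1) →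
    Summable fun k : Fin n → ℕ => ∏ i, x i ^ k i
  | 0, _, _ => (hasSum_fintype _).summable
  | n + 1, x, hx => by
    rw [← (Fin.consEquiv fun _ : Fin (n + 1) => ℕ).summable_iff]
    have h1 := summable_geometric_of_lt_one (hx 0).1 (hx 0).2
    have h2 := summable_prod_pow (x := fun i => x i.succ) fun i => hx _
    have := h1.mul_of_nonneg h2 (fun m => pow_nonneg (hx 0).1 m)
      (fun k => Finset.prod_nonneg fun i _ => pow_nonneg (hx i.succ).1 _)
    refine this.congr ?_
    intro p
    simp [Fin.prod_univ_succ, Fin.consEquiv]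

lemma norm_torusCoeff_le {F : (Fin n → ℂ) → ℂ} (hF : DifferentiableOn ℂ F (polydisc n))
    {r : Fin n → ℝ} (hr : ∀ i, r i ∈ Ico (0 : ℝ) 1) :
    ∃ M : ℝ, ∀ k, ‖torusCoeff F r k‖ ≤ M := by
  have hc := continuous_comp_torus hF.continuousOn hr
  refine ⟨∫ t, ‖F (torusPoint r t)‖ ∂torusMeasure n, fun k => ?_⟩
  refine (norm_integral_le_integral_norm _).trans (le_of_eq ?_)
  congr 1; ext t
  simp [UnitAddTorus.mFourier, fourier_apply, norm_toCircle]

lemma summable_norm_taylor {F : (Fin n → ℂ) → ℂ} (hF : DifferentiableOn ℂ F (polydisc n))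
    {r : Fin n → ℝ} (hr : ∀ i, r i ∈ Ico (0 : ℝ) 1) :
    Summable fun k : Fin n → ℕ => ‖taylorCoeff F k‖ * ∏ i, r i ^ k i := by
  set R : Fin n → ℝ := fun i => (1 + r i) / 2 with hR
  have hR0 : ∀ i, 0 < R i := fun i => by have := (hr i).1; simp only [hR]; linarith
  have hRm : ∀ i, R i ∈ Ico (0 : ℝ) 1 := fun i =>
    ⟨(hR0 i).le, by have := (hr i).2; simp only [hR]; linarith⟩
  have hrR : ∀ i, r i / R i ∈ Ico (0 : ℝ) 1 := fun i =>
    ⟨div_nonneg (hr i).1 (hR0 i).le, by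
      rw [div_lt_one (hR0 i)]; have := (hr i).2; simp only [hR]; linarith⟩
  obtain ⟨M, hM⟩ := norm_torusCoeff_le hF hRm
  refine Summable.of_nonneg_of_le (fun k => ?_) (fun k => ?_) ((summable_prod_pow hrR).mul_left M)
  · exact mul_nonneg (norm_nonneg _) (Finset.prod_nonneg fun i _ => pow_nonneg (hr i).1 _)
  · have h1 := hM (natIdx k)
    rw [torusCoeff_natIdx hF hRm, norm_mul, norm_prod] at h1
    have h2 : ∏ i, ‖((R i : ℂ)) ^ k i‖ = ∏ i, R i ^ k i := by
      refine Finset.prod_congr rfl fun i _ => ?_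
      simp [abs_of_pos (hR0 i)]
    rw [h2] at h1
    have h3 : ∏ i, r i ^ k i = (∏ i, R i ^ k i) * ∏ i, (r i / R i) ^ k i := by
      rw [← Finset.prod_mul_distrib]
      refine Finset.prod_congr rfl fun i _ => ?_
      rw [← mul_pow, mul_div_cancel₀ _ (hR0 i).ne']
    rw [h3, ← mul_assoc]
    exact mul_le_mul_of_nonneg_right h1 (Finset.prod_nonneg fun i _ => pow_nonneg (hrR i).1 _)

section Torus

noncomputable local instance : MeasureSpace UnitAddCircle := ⟨AddCircle.haarAddCircle⟩

local instance : IsProbabilityMeasure (volume : Measure UnitAddCircle) :=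
  inferInstanceAs (IsProbabilityMeasure AddCircle.haarAddCircle)

lemma mFourierCoeff_eq (F : (Fin n → ℂ) → ℂ) (r : Fin n → ℝ) (k : Fin n → ℤ) :
    UnitAddTorus.mFourierCoeff (fun t => F (torusPoint r t)) k = torusCoeff F r k := rfl

lemma hasSum_taylor_torus {F : (Fin n → ℂ) → ℂ} (hF : DifferentiableOn ℂ F (polydisc n))
    {r : Fin n → ℝ} (hr : ∀ i, r i ∈ Ico (0 : ℝ) 1) (t : Fin n → UnitAddCircle) :
    HasSum (fun k : Fin n → ℕ => taylorCoeff F k * ∏ i, torusPoint r t i ^ k i)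
      (F (torusPoint r t)) := by
  set f : C(UnitAddTorus (Fin n), ℂ) :=
    ⟨fun t => F (torusPoint r t), continuous_comp_torus hF.continuousOn hr⟩ with hf
  have hc : ∀ k, UnitAddTorus.mFourierCoeff f k = torusCoeff F r k := fun k => rfl
  have hsupp : ∀ k ∉ range (natIdx (n := n)), torusCoeff F r k = 0 := by
    intro k hk
    by_cases h : ∃ i, k i < 0
    · obtain ⟨i, hi⟩ := h
      exact torusCoeff_of_neg hF hr hi
    · push Not at h
      exact absurd ⟨fun i => (k i).toNat, by ext i; simp [natIdx, h i]⟩ hk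
  have hs : Summable (UnitAddTorus.mFourierCoeff f) := by
    rw [← natIdx_injective.summable_iff (fun k hk => by rw [hc]; exact hsupp k hk)]
    refine Summable.of_norm ((summable_norm_taylor hF hr).congr fun k => ?_)
    simp only [Function.comp, hc, torusCoeff_natIdx hF hr, norm_mul, norm_prod, norm_pow]
    congr 1
    refine Finset.prod_congr rfl fun i _ => ?_
    simp [abs_of_nonneg (hr i).1]
  have h := UnitAddTorus.hasSum_mFourier_series_apply_of_summable hs t
  rw [← natIdx_injective.hasSum_iff (fun k hk => by rw [hc, hsupp k hk, zero_smul])] at h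
  refine h.congr_fun fun k => ?_
  simp only [Function.comp, hc, torusCoeff_natIdx hF hr, smul_eq_mul, mul_assoc,
    UnitAddTorus.mFourier, ContinuousMap.coe_mk, ← Finset.prod_mul_distrib]
  congr 1
  refine Finset.prod_congr rfl fun i _ => ?_
  simp [torusPoint, mul_pow, natIdx, fourier_apply, AddCircle.toCircle_nsmul]

lemma hasSum_taylor_sq {F : (Fin n → ℂ) → ℂ} (hF : DifferentiableOn ℂ F (polydisc n))
    {r : Fin n → ℝ} (hr : ∀ i, r i ∈ Ico (0 : ℝ) 1) :
    HasSum (fun k : Fin n → ℕ => (‖taylorCoeff F k‖ * ∏ i, r i ^ k i) ^ 2)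
      (∫ t, ‖F (torusPoint r t)‖ ^ 2 ∂torusMeasure n) := by
  set f : C(UnitAddTorus (Fin n), ℂ) :=
    ⟨fun t => F (torusPoint r t), continuous_comp_torus hF.continuousOn hr⟩ with hf
  have hc : ∀ k, UnitAddTorus.mFourierCoeff f k = torusCoeff F r k := fun k => rfl
  have hsupp : ∀ k ∉ range (natIdx (n := n)), torusCoeff F r k = 0 := by
    intro k hk
    by_cases h : ∃ i, k i < 0
    · obtain ⟨i, hi⟩ := h
      exact torusCoeff_of_neg hF hr hi
    · push Not at h
      exact absurd ⟨fun i => (k i).toNat, by ext i; simp [natIdx, h i]⟩ hk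
  have h := UnitAddTorus.hasSum_sq_mFourierCoeff (f.toLp 2 volume ℂ)
  simp only [UnitAddTorus.mFourierCoeff_toLp, hc] at h
  have e : ∫ t, ‖(f.toLp 2 volume ℂ) t‖ ^ 2 = ∫ t, ‖F (torusPoint r t)‖ ^ 2 ∂torusMeasure n := by
    refine integral_congr_ae ?_
    filter_upwards [ContinuousMap.coeFn_toLp (p := 2) (𝕜 := ℂ) volume f] with t ht
    rw [ht]; rfl
  rw [e, ← natIdx_injective.hasSum_iff (fun k hk => by rw [hsupp k hk]; simp)] at h
  refine h.congr_fun fun k => ?_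
  simp only [Function.comp, torusCoeff_natIdx hF hr, norm_mul, norm_prod, norm_pow]
  congr 2
  refine Finset.prod_congr rfl fun i _ => ?_
  simp [abs_of_nonneg (hr i).1]

end Torus

lemma exists_torusPoint (z : Fin n → ℂ) :
    ∃ t, torusPoint (fun i => ‖z i‖) t = z := by
  have : ∀ i, ∃ t : UnitAddCircle, (‖z i‖ : ℂ) * (AddCircle.toCircle t : ℂ) = z i := by
    intro i
    obtain ⟨t, ht⟩ := (AddCircle.homeomorphCircle (T := 1) one_ne_zero).surjective
      (Circle.exp (Complex.arg (z i)))
    refine ⟨t, ?_⟩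
    rw [AddCircle.homeomorphCircle_apply] at ht
    rw [ht]
    simp
  choose t ht using this
  exact ⟨t, funext ht⟩

lemma hasSum_taylor {F : (Fin n → ℂ) → ℂ} (hF : DifferentiableOn ℂ F (polydisc n))
    {z : Fin n → ℂ} (hz : z ∈ polydisc n) :
    HasSum (fun k : Fin n → ℕ => taylorCoeff F k * ∏ i, z i ^ k i) (F z) := by
  obtain ⟨t, ht⟩ := exists_torusPoint z
  have := hasSum_taylor_torus hF (r := fun i => ‖z i‖) (fun i => ⟨norm_nonneg _, hz i⟩) t
  rwa [ht] at this


lemma norm_prod_pow_le {z : Fin n → ℂ} {R : ℝ} (hz : ‖z‖ ≤ R) (k : Fin n → ℕ) :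
    ‖∏ i, z i ^ k i‖ ≤ ∏ i, R ^ k i := by
  rw [norm_prod]
  refine Finset.prod_le_prod (fun i _ => norm_nonneg _) fun i _ => ?_
  rw [norm_pow]
  exact pow_le_pow_left₀ (norm_nonneg _) ((norm_le_pi_norm z i).trans hz) _

lemma mem_polydisc_iff {z : Fin n → ℂ} : z ∈ polydisc n ↔ ‖z‖ < 1 := by
  rw [pi_norm_lt_iff one_pos]; rfl

lemma summable_of_bounded {a : (Fin n → ℕ) → ℂ} {C : ℝ} (ha : ∀ k, ‖a k‖ ≤ C)
    {z : Fin n → ℂ} (hz : z ∈ polydisc n) :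
    Summable fun k => a k * ∏ i, z i ^ k i := by
  refine Summable.of_norm_bounded
    ((summable_prod_pow (x := fun i => ‖z i‖) fun i => ⟨norm_nonneg _, hz i⟩).mul_left C) ?_
  intro k
  rw [norm_mul, norm_prod]
  simp only [norm_pow]
  exact mul_le_mul_of_nonneg_right (ha k) (Finset.prod_nonneg fun i _ => by positivity)

lemma differentiableOn_tsum_monomial {a : (Fin n → ℕ) → ℂ} {C : ℝ} (ha : ∀ k, ‖a k‖ ≤ C) :
    DifferentiableOn ℂ (fun z : Fin n → ℂ => ∑' k : Fin n → ℕ, a k * ∏ i, z i ^ k i)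
      (polydisc n) := by
  intro x hx
  have hx1 : ‖x‖ < 1 := mem_polydisc_iff.mp hx
  set δ : ℝ := (1 - ‖x‖) / 4 with hδ
  have hδ0 : 0 < δ := by simp only [hδ]; linarith
  set R : ℝ := ‖x‖ + 2 * δ with hR
  have hR1 : R ∈ Ico (0 : ℝ) 1 := ⟨by positivity, by simp only [hR, hδ]; linarith⟩
  set f : (Fin n → ℕ) → (Fin n → ℂ) → ℂ := fun k z => a k * ∏ i, z i ^ k i with hf
  have hfd : ∀ k, Differentiable ℂ (f k) := by
    intro k
    simp only [hf]
    fun_prop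
  set u : (Fin n → ℕ) → ℝ := fun k => C * ∏ _i : Fin n, R ^ k _i with hu
  have hus : Summable u := (summable_prod_pow (x := fun _ => R) fun _ => hR1).mul_left C
  have hbd : ∀ k z, ‖z‖ ≤ R → ‖f k z‖ ≤ u k := by
    intro k z hz
    simp only [hf, hu, norm_mul]
    exact mul_le_mul (ha k) (norm_prod_pow_le hz k) (norm_nonneg _)
      ((norm_nonneg _).trans (ha k))
  have hder : ∀ k, ∀ y ∈ Metric.ball x δ, ‖fderiv ℂ (f k) y‖ ≤ 2 * u k / δ := by
    intro k y hy
    have hyn : ‖y‖ ≤ ‖x‖ + δ := by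
      have h1 := norm_sub_norm_le y x
      have h2 : ‖y - x‖ < δ := by simpa [dist_eq_norm] using hy
      linarith
    refine Complex.norm_fderiv_le_div_of_mapsTo_ball (hfd k).differentiableOn ?_ hδ0
    intro z hz
    have hzn : ‖z‖ ≤ R := by
      have h1 := norm_sub_norm_le z y
      have h2 : ‖z - y‖ < δ := by simpa [dist_eq_norm] using hz
      simp only [hR]; linarith
    rw [Metric.mem_closedBall, dist_eq_norm]
    have h1 := hbd k z hzn
    have h2 := hbd k y (by simp only [hR]; linarith)
    have h3 := norm_sub_le (f k z) (f k y)
    linarith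
  have hder' : HasFDerivAt (fun z => ∑' k, f k z) (∑' k, fderiv ℂ (f k) x) x := by
    refine hasFDerivAt_tsum_of_isPreconnected (u := fun k => 2 * u k / δ) (x₀ := x)
      ((hus.mul_left 2).div_const δ) Metric.isOpen_ball
      (convex_ball x δ).isPreconnected (fun k y _ => (hfd k y).hasFDerivAt) hder
      (Metric.mem_ball_self hδ0) (summable_of_bounded ha hx) (Metric.mem_ball_self hδ0)
  exact hder'.differentiableAt.differentiableWithinAt

lemma integral_mFourier_mul (k l : Fin n → ℤ) :
    ∫ t, UnitAddTorus.mFourier (-k) t * UnitAddTorus.mFourier l t ∂torusMeasure n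
      = if l = k then 1 else 0 := by
  have h := (orthonormal_iff_ite.mp (UnitAddTorus.orthonormal_mFourier (d := Fin n))) k l
  rw [ContinuousMap.inner_toLp] at h
  simp only [← UnitAddTorus.mFourier_neg, mul_comm (UnitAddTorus.mFourier l _)] at h
  refine Eq.trans ?_ (h.trans (by simp [eq_comm]))
  rfl

lemma taylorCoeff_congr {F G : (Fin n → ℂ) → ℂ} (h : EqOn F G (polydisc n)) (k : Fin n → ℕ) :
    taylorCoeff F k = taylorCoeff G k := by
  unfold taylorCoeff torusCoeff
  congr 2
  ext t
  rw [h (torusPoint_mem (fun _ => by norm_num) t)]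

lemma taylorCoeff_tsum {a : (Fin n → ℕ) → ℂ} {C : ℝ} (ha : ∀ k, ‖a k‖ ≤ C) (k : Fin n → ℕ) :
    taylorCoeff (fun z : Fin n → ℂ => ∑' k : Fin n → ℕ, a k * ∏ i, z i ^ k i) k = a k := by
  set r : Fin n → ℝ := fun _ => 1 / 2 with hr
  have hrm : ∀ i, r i ∈ Ico (0 : ℝ) 1 := fun i => by norm_num [hr]
  have hF : ∀ t, HasSum (fun l : Fin n → ℕ => (a l * ∏ i, (r i : ℂ) ^ l i) *
      (UnitAddTorus.mFourier (-natIdx k) t * UnitAddTorus.mFourier (natIdx l) t))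
      (UnitAddTorus.mFourier (-natIdx k) t *
        ∑' l : Fin n → ℕ, a l * ∏ i, torusPoint r t i ^ l i) := by
    intro t
    have := ((summable_of_bounded ha (torusPoint_mem hrm t)).hasSum).mul_left
      (UnitAddTorus.mFourier (-natIdx k) t)
    refine this.congr_fun fun l => ?_
    have : ∏ i, torusPoint r t i ^ l i
        = (∏ i, (r i : ℂ) ^ l i) * UnitAddTorus.mFourier (natIdx l) t := by
      simp only [UnitAddTorus.mFourier, ContinuousMap.coe_mk, ← Finset.prod_mul_distrib]
      refine Finset.prod_congr rfl fun i _ => ?_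
      simp [torusPoint, mul_pow, natIdx, fourier_apply, AddCircle.toCircle_nsmul]
    rw [this]; ring
  have hnorm : ∀ (l : Fin n → ℕ) t, ‖(a l * ∏ i, (r i : ℂ) ^ l i) *
      (UnitAddTorus.mFourier (-natIdx k) t * UnitAddTorus.mFourier (natIdx l) t)‖
      = ‖a l‖ * ∏ i, r i ^ l i := by
    intro l t
    simp [UnitAddTorus.mFourier, fourier_apply, norm_toCircle, hr]
  have hint := hasSum_integral_of_summable_integral_norm (μ := torusMeasure n)
    (F := fun (l : Fin n → ℕ) t => (a l * ∏ i, (r i : ℂ) ^ l i) *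
      (UnitAddTorus.mFourier (-natIdx k) t * UnitAddTorus.mFourier (natIdx l) t)) ?_ ?_
  · have e : ∀ t, ∑' l : Fin n → ℕ, (a l * ∏ i, (r i : ℂ) ^ l i) *
        (UnitAddTorus.mFourier (-natIdx k) t * UnitAddTorus.mFourier (natIdx l) t) = _ :=
      fun t => (hF t).tsum_eq
    simp only [e, integral_const_mul, integral_mFourier_mul] at hint
    have h2 : HasSum (fun l : Fin n → ℕ => a l * (∏ i, (r i : ℂ) ^ l i) *
        if natIdx l = natIdx k then 1 else 0) (a k * ∏ i, (r i : ℂ) ^ k i) := by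
      refine (hasSum_ite_eq k (a k * ∏ i, (r i : ℂ) ^ k i)).congr_fun fun l => ?_
      by_cases h : l = k
      · simp [h]
      · simp [h, natIdx_injective.ne h]
    have h3 := hint.unique h2
    rw [taylorCoeff, torusCoeff]
    refine (congrArg (· * _) h3).trans ?_
    simp only [hr, mul_assoc, ← Finset.prod_mul_distrib, ← mul_pow]
    simp
  · intro l
    refine Continuous.integrable_of_hasCompactSupport ?_ (HasCompactSupport.of_compactSpace _)
    exact continuous_const.mul
      ((ContinuousMap.continuous _).mul (ContinuousMap.continuous _))
  · simp only [hnorm, integral_const, probReal_univ, one_smul]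
    refine Summable.of_nonneg_of_le (fun l => ?_) (fun l => ?_) ((summable_prod_pow hrm).mul_left C)
    · exact mul_nonneg (norm_nonneg _) (Finset.prod_nonneg fun i _ => pow_nonneg (hrm i).1 _)
    · exact mul_le_mul_of_nonneg_right (ha l) (Finset.prod_nonneg fun i _ => pow_nonneg (hrm i).1 _)

lemma meanSq_le {F : (Fin n → ℂ) → ℂ} (hF : DifferentiableOn ℂ F (polydisc n))
    (hs : Summable fun k => ‖taylorCoeff F k‖ ^ 2) {r : ℝ} (hr : r ∈ Ico (0 : ℝ) 1) :
    meanSq F r ≤ ∑' k, ‖taylorCoeff F k‖ ^ 2 := by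
  have h := hasSum_taylor_sq hF (r := fun _ => r) (fun _ => hr)
  refine hasSum_le (fun k => ?_) h hs.hasSum
  have h1 : ∏ i, r ^ k i ≤ 1 :=
    Finset.prod_le_one (fun i _ => pow_nonneg hr.1 _) fun i _ => pow_le_one₀ hr.1 hr.2.le
  have h0 : 0 ≤ ∏ i, r ^ k i := Finset.prod_nonneg fun i _ => pow_nonneg hr.1 _
  exact pow_le_pow_left₀ (mul_nonneg (norm_nonneg _) h0)
    (mul_le_of_le_one_right (norm_nonneg _) h1) 2

lemma sum_taylor_le {F : (Fin n → ℂ) → ℂ} (hF : DifferentiableOn ℂ F (polydisc n))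
    {M : ℝ} (hM : ∀ r ∈ Ico (0 : ℝ) 1, meanSq F r ≤ M) (S : Finset (Fin n → ℕ)) :
    ∑ k ∈ S, ‖taylorCoeff F k‖ ^ 2 ≤ M := by
  have ht : Tendsto (fun r : ℝ => ∑ k ∈ S, (‖taylorCoeff F k‖ * ∏ i, r ^ k i) ^ 2) (𝓝[<] 1)
      (𝓝 (∑ k ∈ S, (‖taylorCoeff F k‖ * ∏ i, (1 : ℝ) ^ k i) ^ 2)) := by
    refine Tendsto.mono_left (Continuous.tendsto ?_ 1) nhdsWithin_le_nhds
    fun_prop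
  simp only [one_pow, Finset.prod_const_one, mul_one] at ht
  refine le_of_tendsto ht ?_
  filter_upwards [Ico_mem_nhdsLT (zero_lt_one' ℝ)] with r hr
  refine le_trans ?_ (hM r hr)
  exact sum_le_hasSum S (fun k _ => sq_nonneg _) (hasSum_taylor_sq hF (r := fun _ => r) fun _ => hr)

lemma summable_taylor {F : (Fin n → ℂ) → ℂ} (hF : DifferentiableOn ℂ F (polydisc n))
    (hb : BddAbove (meanSq F '' Ico 0 1)) : Summable fun k => ‖taylorCoeff F k‖ ^ 2 := by
  obtain ⟨M, hM⟩ := hb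
  exact summable_of_sum_le (fun k => sq_nonneg _)
    (sum_taylor_le hF (M := M) fun r hr => hM ⟨r, hr, rfl⟩)

lemma bddAbove_of_summable {F : (Fin n → ℂ) → ℂ} (hF : DifferentiableOn ℂ F (polydisc n))
    (hs : Summable fun k => ‖taylorCoeff F k‖ ^ 2) : BddAbove (meanSq F '' Ico 0 1) := by
  refine ⟨∑' k, ‖taylorCoeff F k‖ ^ 2, ?_⟩
  rintro _ ⟨r, hr, rfl⟩
  exact meanSq_le hF hs hr

lemma sSup_meanSq {F : (Fin n → ℂ) → ℂ} (hF : DifferentiableOn ℂ F (polydisc n))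
    (hs : Summable fun k => ‖taylorCoeff F k‖ ^ 2) :
    sSup (meanSq F '' Ico 0 1) = ∑' k, ‖taylorCoeff F k‖ ^ 2 := by
  have hb := bddAbove_of_summable hF hs
  refine le_antisymm ?_ ?_
  · refine csSup_le ⟨_, 0, by norm_num, rfl⟩ ?_
    rintro _ ⟨r, hr, rfl⟩
    exact meanSq_le hF hs hr
  · exact hs.tsum_le_of_sum_le fun S => sum_taylor_le hF (fun r hr => le_csSup hb ⟨r, hr, rfl⟩) S

lemma extendZero_apply (f : polydisc n → ℂ) (z : polydisc n) : extendZero f z = f z := by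
  simp [extendZero]

lemma extendZero_of_mem (f : polydisc n → ℂ) {z : Fin n → ℂ} (hz : z ∈ polydisc n) :
    extendZero f z = f ⟨z, hz⟩ := by
  simp [extendZero, hz]

lemma extendZero_add (f g : polydisc n → ℂ) :
    extendZero (f + g) = extendZero f + extendZero g := by
  ext z; by_cases h : z ∈ polydisc n <;> simp [extendZero, h]

lemma extendZero_mul (f g : polydisc n → ℂ) :
    extendZero (f * g) = extendZero f * extendZero g := by
  ext z; by_cases h : z ∈ polydisc n <;> simp [extendZero, h]

lemma extendZero_smul (c : ℂ) (f : polydisc n → ℂ) :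
    extendZero (c • f) = c • extendZero f := by
  ext z; by_cases h : z ∈ polydisc n <;> simp [extendZero, h]

lemma extendZero_zero : extendZero (0 : polydisc n → ℂ) = 0 := by
  ext z; simp [extendZero]

lemma isHolomorphic_of_eqOn {f : polydisc n → ℂ} {F : (Fin n → ℂ) → ℂ}
    (hF : DifferentiableOn ℂ F (polydisc n)) (h : ∀ z : polydisc n, f z = F z) :
    IsHolomorphic f :=
  hF.congr fun z hz => by rw [extendZero_of_mem f hz, h]

lemma integrable_meanSq {F : (Fin n → ℂ) → ℂ} (hF : DifferentiableOn ℂ F (polydisc n))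
    {r : ℝ} (hr : r ∈ Ico (0 : ℝ) 1) :
    Integrable (fun t => ‖F (torusPoint (fun _ => r) t)‖ ^ 2) (torusMeasure n) := by
  refine Continuous.integrable_of_hasCompactSupport ?_ (HasCompactSupport.of_compactSpace _)
  exact (continuous_comp_torus hF.continuousOn fun _ => hr).norm.pow 2

lemma meanSq_add_le {F G : (Fin n → ℂ) → ℂ} (hF : DifferentiableOn ℂ F (polydisc n))
    (hG : DifferentiableOn ℂ G (polydisc n)) {r : ℝ} (hr : r ∈ Ico (0 : ℝ) 1) :
    meanSq (F + G) r ≤ 2 * meanSq F r + 2 * meanSq G r := by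
  have h1 := integrable_meanSq hF hr
  have h2 := integrable_meanSq hG hr
  unfold meanSq
  rw [← integral_const_mul, ← integral_const_mul, ← integral_add (h1.const_mul 2) (h2.const_mul 2)]
  refine integral_mono (integrable_meanSq (hF.add hG) hr)
    ((h1.const_mul 2).add (h2.const_mul 2)) fun t => ?_
  have := norm_add_le (F (torusPoint (fun _ => r) t)) (G (torusPoint (fun _ => r) t))
  have h0 := norm_nonneg (F (torusPoint (fun _ => r) t) + G (torusPoint (fun _ => r) t))
  simp only [Pi.add_apply]
  nlinarith [sq_nonneg (‖F (torusPoint (fun _ => r) t)‖ - ‖G (torusPoint (fun _ => r) t)‖)]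

lemma meanSq_mul_le {F G : (Fin n → ℂ) → ℂ} (hF : DifferentiableOn ℂ F (polydisc n))
    (hG : DifferentiableOn ℂ G (polydisc n)) {C : ℝ} (hC : ∀ z ∈ polydisc n, ‖F z‖ ≤ C)
    {r : ℝ} (hr : r ∈ Ico (0 : ℝ) 1) :
    meanSq (F * G) r ≤ C ^ 2 * meanSq G r := by
  unfold meanSq
  rw [← integral_const_mul]
  refine integral_mono (integrable_meanSq (hF.mul hG) hr)
    ((integrable_meanSq hG hr).const_mul _) fun t => ?_
  have := hC _ (torusPoint_mem (fun _ => hr) t)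
  simp only [Pi.mul_apply, norm_mul, mul_pow]
  gcongr

end PowerSeries

/-! ### The Hardy space `H²(𝔻ⁿ)` -/

/-- The vector space of holomorphic functions `f` on `𝔻ⁿ` with
`sup_{0 ≤ r < 1} ∫_{𝕋ⁿ} |f(r z)|² dθ < ∞`. -/
noncomputable def hardySubmodule (n : ℕ) : Submodule ℂ (polydisc n → ℂ) where
  carrier := {f | IsHolomorphic f ∧ BddAbove (meanSq (extendZero f) '' Ico 0 1)}
  zero_mem' := by
    refine ⟨?_, 0, ?_⟩
    · rw [IsHolomorphic, extendZero_zero]; exact differentiableOn_const 0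
    · rintro _ ⟨r, -, rfl⟩
      simp [extendZero_zero, meanSq]
  add_mem' := by
    rintro f g ⟨hf, Mf, hMf⟩ ⟨hg, Mg, hMg⟩
    refine ⟨?_, 2 * Mf + 2 * Mg, ?_⟩
    · rw [IsHolomorphic, extendZero_add]; exact DifferentiableOn.add hf hg
    · rintro _ ⟨r, hr, rfl⟩
      rw [extendZero_add]
      have h1 := hMf ⟨r, hr, rfl⟩
      have h2 := hMg ⟨r, hr, rfl⟩
      linarith [meanSq_add_le hf hg hr]
  smul_mem' := by
    rintro c f ⟨hf, Mf, hMf⟩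
    refine ⟨?_, ‖c‖ ^ 2 * Mf, ?_⟩
    · rw [IsHolomorphic, extendZero_smul]; exact DifferentiableOn.const_smul hf c
    · rintro _ ⟨r, hr, rfl⟩
      have h1 := hMf ⟨r, hr, rfl⟩
      have : meanSq (extendZero (c • f)) r = ‖c‖ ^ 2 * meanSq (extendZero f) r := by
        unfold meanSq
        rw [← integral_const_mul]
        simp [extendZero_smul, mul_pow]
      rw [this]
      gcongr

/-- The Hardy space `H²(𝔻ⁿ)`. -/
def HardySpace (n : ℕ) : Type := hardySubmodule n

namespace HardySpace

variable {n : ℕ}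

noncomputable instance : AddCommGroup (HardySpace n) :=
  inferInstanceAs (AddCommGroup (hardySubmodule n))

noncomputable instance : Module ℂ (HardySpace n) :=
  inferInstanceAs (Module ℂ (hardySubmodule n))

instance : FunLike (HardySpace n) (polydisc n) ℂ where
  coe f := f.1
  coe_injective := Subtype.coe_injective

@[simp] lemma add_apply (f g : HardySpace n) (z : polydisc n) : (f + g) z = f z + g z := rfl

@[simp] lemma smul_apply (c : ℂ) (f : HardySpace n) (z : polydisc n) : (c • f) z = c * f z := rfl

lemma holo (f : HardySpace n) : DifferentiableOn ℂ (extendZero f) (polydisc n) := f.2.1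

lemma bdd (f : HardySpace n) : BddAbove (meanSq (extendZero f) '' Ico 0 1) := f.2.2

/-- `‖f‖ = (sup_{0 ≤ r < 1} ∫_{𝕋ⁿ} |f(r z)|² dθ)^{1/2}`. -/
noncomputable instance : Norm (HardySpace n) where
  norm f := √(sSup (meanSq (extendZero f) '' Ico 0 1))

lemma norm_def (f : HardySpace n) : ‖f‖ = √(sSup (meanSq (extendZero f) '' Ico 0 1)) := rfl

/-- Square-summable families of Taylor coefficients. -/
abbrev Coeffs (n : ℕ) : Type := lp (fun _ : Fin n → ℕ => ℂ) 2

lemma summable_coeffs (a : Coeffs n) : Summable fun k => ‖a k‖ ^ 2 := by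
  have := (lp.memℓp a).summable (by norm_num)
  simpa using this

lemma norm_coeffs (a : Coeffs n) : ‖a‖ = √(∑' k, ‖a k‖ ^ 2) := by
  rw [lp.norm_eq_tsum_rpow (by norm_num), Real.sqrt_eq_rpow]
  norm_num

lemma norm_coeffs_le (a : Coeffs n) (k : Fin n → ℕ) : ‖a k‖ ≤ ‖a‖ :=
  lp.norm_apply_le_norm (by norm_num) a k

lemma taylorCoeff_of_tsum {f : polydisc n → ℂ} (a : Coeffs n)
    (h : ∀ z : polydisc n, f z = ∑' k : Fin n → ℕ, a k * ∏ i, z.1 i ^ k i) (k : Fin n → ℕ) :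
    taylorCoeff (extendZero f) k = a k := by
  rw [← taylorCoeff_tsum (norm_coeffs_le a) k]
  refine taylorCoeff_congr (fun z hz => ?_) k
  rw [extendZero_of_mem f hz, h]

/-- The function with given square-summable Taylor coefficients. -/
noncomputable def synth : Coeffs n →ₗ[ℂ] HardySpace n where
  toFun a := ⟨fun z => ∑' k : Fin n → ℕ, a k * ∏ i, z.1 i ^ k i, by
    have hd := isHolomorphic_of_eqOn (f := fun z => ∑' k : Fin n → ℕ, a k * ∏ i, z.1 i ^ k i)
      (differentiableOn_tsum_monomial (norm_coeffs_le a)) fun z => rfl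
    refine ⟨hd, bddAbove_of_summable hd ?_⟩
    simp only [taylorCoeff_of_tsum a fun _ => rfl]
    exact summable_coeffs a⟩
  map_add' a b := by
    refine Subtype.ext (funext fun z => ?_)
    change ∑' k : Fin n → ℕ, (a + b) k * ∏ i, z.1 i ^ k i
      = (∑' k : Fin n → ℕ, a k * ∏ i, z.1 i ^ k i) + ∑' k : Fin n → ℕ, b k * ∏ i, z.1 i ^ k i
    rw [← (summable_of_bounded (norm_coeffs_le a) z.2).tsum_add
      (summable_of_bounded (norm_coeffs_le b) z.2)]
    simp [add_mul]
  map_smul' c a := by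
    refine Subtype.ext (funext fun z => ?_)
    change ∑' k : Fin n → ℕ, (c • a) k * ∏ i, z.1 i ^ k i
      = c * ∑' k : Fin n → ℕ, a k * ∏ i, z.1 i ^ k i
    rw [← tsum_mul_left]
    simp [mul_assoc]

lemma synth_apply (a : Coeffs n) (z : polydisc n) :
    synth a z = ∑' k : Fin n → ℕ, a k * ∏ i, z.1 i ^ k i := rfl

lemma taylorCoeff_synth (a : Coeffs n) (k : Fin n → ℕ) :
    taylorCoeff (extendZero (synth a)) k = a k :=
  taylorCoeff_of_tsum a (synth_apply a) k

lemma norm_synth (a : Coeffs n) : ‖synth a‖ = ‖a‖ := by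
  rw [norm_def, norm_coeffs, sSup_meanSq (holo _) (summable_taylor (holo _) (bdd _))]
  simp only [taylorCoeff_synth]

lemma synth_bijective : Function.Bijective (synth (n := n)) := by
  constructor
  · intro a b h
    ext k
    rw [← taylorCoeff_synth a, ← taylorCoeff_synth b, h]
  · intro f
    have hs := summable_taylor f.holo f.bdd
    refine ⟨⟨taylorCoeff (extendZero f), memℓp_gen (by simpa using hs)⟩, ?_⟩
    refine DFunLike.ext _ _ fun z => ?_
    rw [synth_apply, ← extendZero_apply f z]
    exact (hasSum_taylor f.holo z.2).tsum_eq

/-- Taylor coefficients identify `H²(𝔻ⁿ)` with `ℓ²(ℕⁿ)`. -/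
noncomputable def coeffEquiv : Coeffs n ≃ₗ[ℂ] HardySpace n :=
  LinearEquiv.ofBijective synth synth_bijective

lemma norm_coeffEquiv_symm (f : HardySpace n) : ‖coeffEquiv.symm f‖ = ‖f‖ := by
  conv_rhs => rw [← coeffEquiv.apply_symm_apply f]
  exact (norm_synth _).symm

lemma normCore (n : ℕ) : NormedSpace.Core ℂ (HardySpace n) where
  norm_nonneg _ := Real.sqrt_nonneg _
  norm_smul c f := by
    rw [← norm_coeffEquiv_symm, map_smul, norm_smul, norm_coeffEquiv_symm]
  norm_triangle f g := by
    rw [← norm_coeffEquiv_symm, map_add, ← norm_coeffEquiv_symm f, ← norm_coeffEquiv_symm g]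
    exact norm_add_le _ _
  norm_eq_zero_iff f := by
    rw [← norm_coeffEquiv_symm, norm_eq_zero, LinearEquiv.map_eq_zero_iff]

noncomputable instance : NormedAddCommGroup (HardySpace n) :=
  NormedAddCommGroup.ofCore (normCore n)

noncomputable instance : NormedSpace ℂ (HardySpace n) :=
  NormedSpace.ofCore (normCore n)

/-- The inner product of `H²(𝔻ⁿ)`: the one (given by polarization) that induces the norm. -/
noncomputable instance : InnerProductSpace ℂ (HardySpace n) :=
  InnerProductSpace.ofNorm ℂ fun f g => by
    simp only [← norm_coeffEquiv_symm, map_add, map_sub]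
    exact parallelogram_law_with_norm_mul ℂ _ _

/-- Taylor coefficients identify `H²(𝔻ⁿ)` isometrically with `ℓ²(ℕⁿ)`. -/
noncomputable def coeffIsometry : HardySpace n ≃ₗᵢ[ℂ] Coeffs n where
  toLinearEquiv := coeffEquiv.symm
  norm_map' := norm_coeffEquiv_symm

instance : CompleteSpace (HardySpace n) :=
  (coeffIsometry (n := n)).toIsometryEquiv.completeSpace

end HardySpace

/-! ### Multiplication operators -/

/-- `H^∞(𝔻ⁿ)`: bounded holomorphic functions on the polydisc. -/
structure IsHInfty {n : ℕ} (φ : polydisc n → ℂ) : Prop where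
  holo : IsHolomorphic φ
  bdd : ∃ C : ℝ, ∀ z, ‖φ z‖ ≤ C

lemma meanSq_mul_mem_le {n : ℕ} {φ : polydisc n → ℂ} (hφ : IsHolomorphic φ) {C : ℝ}
    (hC : ∀ z, ‖φ z‖ ≤ C) (f : HardySpace n) :
    ∀ x ∈ meanSq (extendZero (φ * ⇑f)) '' Ico 0 1,
      x ≤ C ^ 2 * sSup (meanSq (extendZero f) '' Ico 0 1) := by
  rintro _ ⟨r, hr, rfl⟩
  rw [extendZero_mul]
  refine (meanSq_mul_le hφ f.holo (C := C)
    (fun z hz => by rw [extendZero_of_mem φ hz]; exact hC _) hr).trans ?_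
  gcongr
  exact le_csSup f.bdd ⟨r, hr, rfl⟩

lemma mul_mem_hardy {n : ℕ} {φ : polydisc n → ℂ} (hφ : IsHInfty φ) (f : HardySpace n) :
    φ * ⇑f ∈ hardySubmodule n := by
  obtain ⟨C, hC⟩ := hφ.bdd
  refine ⟨?_, _, meanSq_mul_mem_le hφ.holo hC f⟩
  rw [IsHolomorphic, extendZero_mul]
  exact hφ.holo.mul f.holo

/-- Multiplication by `φ ∈ H^∞(𝔻ⁿ)` as a linear map on `H²(𝔻ⁿ)`. -/
def mulLin {n : ℕ} (φ : polydisc n → ℂ) (hφ : IsHInfty φ) : HardySpace n →ₗ[ℂ] HardySpace n where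
  toFun f := ⟨φ * ⇑f, mul_mem_hardy hφ f⟩
  map_add' f g := Subtype.ext (mul_add φ ⇑f ⇑g)
  map_smul' c f := Subtype.ext (mul_smul_comm c φ ⇑f)

lemma norm_mulLin_le {n : ℕ} {φ : polydisc n → ℂ} (hφ : IsHInfty φ) :
    ∃ C : ℝ, ∀ f : HardySpace n, ‖mulLin φ hφ f‖ ≤ C * ‖f‖ := by
  obtain ⟨C, hC⟩ := hφ.bdd
  have hC0 : 0 ≤ C := (norm_nonneg _).trans (hC ⟨0, fun i => by simp⟩)
  refine ⟨C, fun f => ?_⟩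
  rw [HardySpace.norm_def, HardySpace.norm_def]
  have hne : (meanSq (extendZero (φ * ⇑f)) '' Ico 0 1).Nonempty :=
    ⟨_, 0, by norm_num, rfl⟩
  refine (Real.sqrt_le_sqrt (csSup_le hne (meanSq_mul_mem_le hφ.holo hC f))).trans ?_
  rw [Real.sqrt_mul (sq_nonneg _), Real.sqrt_sq hC0]

/-- The multiplication operator `M_φ f = φ f` on `H²(𝔻ⁿ)`, for `φ ∈ H^∞(𝔻ⁿ)`. -/
noncomputable def mulOp {n : ℕ} (φ : polydisc n → ℂ) (hφ : IsHInfty φ) : HardySpace n →L[ℂ] HardySpace n :=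
  (mulLin φ hφ).mkContinuousOfExistsBound (norm_mulLin_le hφ)

lemma mulOp_apply {n : ℕ} (φ : polydisc n → ℂ) (hφ : IsHInfty φ) (f : HardySpace n)
    (z : polydisc n) : mulOp φ hφ f z = φ z * f z := rfl

/-- For a function `Θ` on the disc, the function `z ↦ Θ(z_i)` on `𝔻ⁿ`. -/
def liftVar {n : ℕ} (Θ : ℂ → ℂ) (i : Fin n) : polydisc n → ℂ := fun z => Θ (z.1 i)

lemma isHInfty_liftVar {n : ℕ} {Θ : ℂ → ℂ} (hd : DifferentiableOn ℂ Θ (Metric.ball 0 1))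
    (hb : ∃ C : ℝ, ∀ z ∈ Metric.ball (0 : ℂ) 1, ‖Θ z‖ ≤ C) (i : Fin n) :
    IsHInfty (liftVar Θ i) where
  holo := isHolomorphic_of_eqOn (F := fun z => Θ (z i))
    (hd.comp (differentiable_apply i).differentiableOn fun z hz => by simpa using hz i)
    fun _ => rfl
  bdd := by
    obtain ⟨C, hC⟩ := hb
    exact ⟨C, fun z => hC _ (by simpa using z.2 i)⟩

/-- The operator `M_{z_i}` of multiplication by the `i`-th coordinate function. -/
noncomputable def mulCoord {n : ℕ} (i : Fin n) : HardySpace n →L[ℂ] HardySpace n :=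
  mulOp (liftVar id i) (isHInfty_liftVar differentiableOn_id
    ⟨1, fun z hz => by simpa using (mem_ball_zero_iff.mp hz).le⟩ i)

/-- Inner functions on the unit disc: bounded holomorphic functions (only the values of `Θ` on the
open unit disc matter) whose radial limits exist and are unimodular at almost every boundary
point. -/
structure IsInner (Θ : ℂ → ℂ) : Prop where
  holo : DifferentiableOn ℂ Θ (Metric.ball 0 1)
  bdd : ∃ C : ℝ, ∀ z ∈ Metric.ball (0 : ℂ) 1, ‖Θ z‖ ≤ C
  radial : ∀ᵐ t ∂(AddCircle.haarAddCircle : Measure UnitAddCircle), ∃ ζ : ℂ, ‖ζ‖ = 1 ∧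
    Tendsto (fun r : ℝ => Θ ((r : ℂ) * (AddCircle.toCircle t : ℂ))) (𝓝[<] 1) (𝓝 ζ)

/-- The operator `M_{Θ̃}` on `H²(𝔻ⁿ)`, where `Θ̃(z) = Θ(z_i)`. -/
noncomputable def mulInner {n : ℕ} {Θ : ℂ → ℂ} (hΘ : IsInner Θ) (i : Fin n) :
    HardySpace n →L[ℂ] HardySpace n :=
  mulOp (liftVar Θ i) (isHInfty_liftVar hΘ.holo hΘ.bdd i)

/-! ### Quotient modules -/

/-- A closed subspace `S` of `H²(𝔻ⁿ)` is a submodule if `M_{z_i} S ⊆ S` for all `i`. -/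
def IsSubmodule {n : ℕ} (S : ClosedSubmodule ℂ (HardySpace n)) : Prop :=
  ∀ i, ∀ f ∈ S, mulCoord i f ∈ S

/-- A closed subspace `Q` of `H²(𝔻ⁿ)` is a quotient module if `Qᗮ` is a submodule. -/
def IsQuotientModule {n : ℕ} (Q : ClosedSubmodule ℂ (HardySpace n)) : Prop :=
  IsSubmodule Q.orthogonal

instance {n : ℕ} (Q : ClosedSubmodule ℂ (HardySpace n)) : CompleteSpace Q.toSubmodule :=
  Q.isClosed'.completeSpace_coe

/-- The compression `C_{z_i} = P_Q M_{z_i}|_Q`. -/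
noncomputable def compression {n : ℕ} (Q : ClosedSubmodule ℂ (HardySpace n)) (i : Fin n) :
    Q.toSubmodule →L[ℂ] Q.toSubmodule :=
  Q.toSubmodule.orthogonalProjectionOnto ∘L mulCoord i ∘L Q.toSubmodule.subtypeL

/-- `Q` is a doubly commuting quotient module: it is a quotient module and
`C_{z_i} C_{z_j}^* = C_{z_j}^* C_{z_i}` for `i < j`. -/
structure IsDoublyCommuting {n : ℕ} (Q : ClosedSubmodule ℂ (HardySpace n)) : Prop where
  isQuotientModule : IsQuotientModule Q
  comm : ∀ i j : Fin n, i < j →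
    compression Q i ∘L (compression Q j).adjoint = (compression Q j).adjoint ∘L compression Q i

end PolydiscHardy

namespace PolydiscHardy

/-! ### Doubly commuting compressions of doubly commuting isometries -/

section Abstract

/-! Write M_i for M_{z_i} and P for the projection onto Q. For a set J of coordinates let H_J be the
closed span of the vectors A q with q in Q and A a product of operators M_j, j ∈ J (`hull`); thus
H_∅ = Q. Since Q is invariant under all M_i^* and the M_i are doubly commuting isometries, every H_J
is invariant under all M_i^*, and H_J reduces M_j for j ∈ J. Double commutativity of the
compressions gives P B^* P A P = P B^* A P for words A, B in disjoint sets of coordinates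
(`compress_star_mul_words`). It follows that the projections p_J onto H_J satisfy p_K p_J = p_{J ∩
K} (`hull_starProjection_mul`). Hence they commute, and P is the product of the p_{{i}ᶜ} over all i.

The orthogonal complement of H_{{i}ᶜ} is invariant under every M_j and reduces M_j for j ≠ i. By a
form of Beurling's theorem (`IsReducingExcept.exists_isInner`) it is either 0 or Θ(z_i)H² with Θ
inner; in the second case p_{{i}ᶜ} = 1 - M M^* with M multiplication by Θ(z_i). Indices with zero
complement contribute the factor 1 and are dropped. If P x = 0, then x = x - ∏ p_{{i}ᶜ} x telescopes
into a finite sum of elements of the complements (`sub_prod_apply_mem`), so the sum needs no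
closure.

For Beurling's theorem, project onto S the lowest power of z_i whose projection is not 0. After
normalization this is a function g for which the z^α g are orthonormal, so multiplication by g is an
isometry into S, and it turns out to be onto. Moreover g depends on z_i alone and |g| ≤ 1. Radial
limits exist by Fatou's theorem (`ae_exists_radial_limit`), derived here from almost everywhere
differentiability of Lipschitz functions, and ‖g‖ = 1 forces them to be unimodular. -/

lemma commute_of_mem_closure {R : Type*} [Monoid R] {s : Set R} {a y : R}
    (h : ∀ x ∈ s, Commute a x) (hy : y ∈ Submonoid.closure s) : Commute a y := by
  induction hy using Submonoid.closure_induction with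
  | mem x hx => exact h x hx
  | one => exact Commute.one_right a
  | mul x y _ _ hx hy => exact hx.mul_right hy

/-- Products of the operators `M j` with `j ∈ J`. -/
def words {ι R : Type*} [Monoid R] (M : ι → R) (J : Set ι) : Submonoid R :=
  Submonoid.closure (M '' J)

/-! ### Words in commuting operators and their compressions -/

section Words

variable {ι R : Type*} [Ring R] {M : ι → R}

lemma mem_words {J : Set ι} {j : ι} (hj : j ∈ J) : M j ∈ words M J :=
  Submonoid.subset_closure ⟨j, hj, rfl⟩

lemma words_mono {J K : Set ι} (h : J ⊆ K) {A : R} (hA : A ∈ words M J) : A ∈ words M K :=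
  Submonoid.closure_mono (image_mono h) hA

lemma commute_words (hM : ∀ i j, Commute (M i) (M j)) {J K : Set ι} {A B : R}
    (hA : A ∈ words M J) (hB : B ∈ words M K) : Commute A B := by
  refine commute_of_mem_closure ?_ hB
  rintro _ ⟨k, -, rfl⟩
  refine (commute_of_mem_closure ?_ hA).symm
  rintro _ ⟨j, -, rfl⟩
  exact hM k j

/-- The letters commute, so those with index in K can be moved to the left. -/
lemma exists_mul_of_mem_words (hM : ∀ i j, Commute (M i) (M j)) {J : Set ι} (K : Set ι) {A : R}
    (hA : A ∈ words M J) : ∃ B ∈ words M (J ∩ K), ∃ C ∈ words M (J \ K), A = B * C := by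
  induction hA using Submonoid.closure_induction with
  | mem x hx =>
    obtain ⟨j, hj, rfl⟩ := hx
    by_cases hk : j ∈ K
    · exact ⟨M j, mem_words ⟨hj, hk⟩, 1, one_mem _, (mul_one _).symm⟩
    · exact ⟨1, one_mem _, M j, mem_words ⟨hj, hk⟩, (one_mul _).symm⟩
  | one => exact ⟨1, one_mem _, 1, one_mem _, (mul_one _).symm⟩
  | mul x y _ _ hx hy =>
    obtain ⟨B, hB, C, hC, rfl⟩ := hx
    obtain ⟨B', hB', C', hC', rfl⟩ := hy
    refine ⟨B * B', mul_mem hB hB', C * C', mul_mem hC hC', ?_⟩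
    have h := (commute_words hM hC hB').eq
    calc B * C * (B' * C') = B * (C * B') * C' := by noncomm_ring
      _ = _ := by rw [h]; noncomm_ring

variable [StarRing R]

lemma commute_star_words (hM : ∀ i j, i ≠ j → Commute (M i) (star (M j))) {J K : Set ι}
    (hJK : Disjoint J K) {A B : R} (hA : A ∈ words M J) (hB : B ∈ words M K) :
    Commute A (star B) := by
  rw [← commute_star_star, star_star]
  refine commute_of_mem_closure ?_ hB
  rintro _ ⟨k, hk, rfl⟩
  rw [← commute_star_star, star_star]
  refine (commute_of_mem_closure ?_ hA).symm
  rintro _ ⟨j, hj, rfl⟩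
  exact (hM j k fun h => disjoint_left.1 hJK hj (h ▸ hk)).symm

variable {P : R}

/-- `hPM` says that the range of P is invariant under each `star (M i)`, hence under adjoints of
words. Consequently A ↦ P A P is multiplicative on words. -/
lemma compress_words (hP : IsStarProjection P) (hPM : ∀ i, P * M i * P = P * M i) {J : Set ι} {A : R}
    (hA : A ∈ words M J) : P * A * P = P * A := by
  induction hA using Submonoid.closure_induction with
  | mem x hx => obtain ⟨j, -, rfl⟩ := hx; exact hPM j
  | one => rw [mul_one, hP.isIdempotentElem.eq]
  | mul x y _ _ hx hy =>
    calc P * (x * y) * P = P * x * y * P := by noncomm_ring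
      _ = P * x * P * y * P := by rw [hx]
      _ = P * x * (P * y * P) := by noncomm_ring
      _ = P * x * P * y := by rw [hy]; noncomm_ring
      _ = _ := by rw [hx, mul_assoc]

lemma compress_star_words (hP : IsStarProjection P) (hPM : ∀ i, P * M i * P = P * M i)
    {J : Set ι} {A : R} (hA : A ∈ words M J) : P * star A * P = star A * P := by
  have h := congrArg star (compress_words hP hPM hA)
  simpa [hP.isSelfAdjoint.star_eq, mul_assoc] using h

/-- Compression is multiplicative on words and on adjoints of words, so commutation passes from the
generators first to A and then to B. -/
lemma commute_compress_words (hP : IsStarProjection P) (hPM : ∀ i, P * M i * P = P * M i)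
    (hC : ∀ i j, i ≠ j → Commute (P * M i * P) (P * star (M j) * P)) {J K : Set ι}
    (hJK : Disjoint J K) {A B : R} (hA : A ∈ words M J) (hB : B ∈ words M K) :
    Commute (P * A * P) (P * star B * P) := by
  have hPP : P * P = P := hP.isIdempotentElem
  have hmul : ∀ {J : Set ι} {x y : R}, x ∈ words M J → y ∈ words M J →
      P * (x * y) * P = (P * x * P) * (P * y * P) := by
    intro J x y hx hy
    rw [compress_words hP hPM (mul_mem hx hy), compress_words hP hPM hx,
      compress_words hP hPM hy, ← mul_assoc (P * x) P y, compress_words hP hPM hx, mul_assoc]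
  have step : ∀ k ∈ K, Commute (P * A * P) (P * star (M k) * P) := by
    intro k hk
    induction hA using Submonoid.closure_induction with
    | mem x hx =>
      obtain ⟨j, hj, rfl⟩ := hx
      exact hC j k fun h => disjoint_left.1 hJK hj (h ▸ hk)
    | one =>
      rw [mul_one, hPP, commute_iff_eq, mul_assoc (P * star (M k)), hPP, ← mul_assoc, ← mul_assoc, hPP]
    | mul x y hx' hy' hx hy =>
      rw [hmul hx' hy']
      exact hx.mul_left hy
  have hXP : Commute (P * A * P) P := by
    rw [commute_iff_eq, mul_assoc (P * A), hPP, ← mul_assoc, ← mul_assoc, hPP]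
  -- The induction on B needs only that X commutes with the compressed generators and with P; the
  -- latter is the case of the empty word, whose compression is P and not 1.
  generalize P * A * P = X at step hXP ⊢
  induction hB using Submonoid.closure_induction with
  | mem x hx => obtain ⟨k, hk, rfl⟩ := hx; exact step k hk
  | one => simpa [hPP] using hXP
  | mul x y hx' hy' hx hy =>
    have : P * star (x * y) * P = (P * star y * P) * (P * star x * P) := by
      rw [compress_star_words hP hPM (mul_mem hx' hy'), compress_star_words hP hPM hx',
        compress_star_words hP hPM hy', mul_assoc (star y), ← mul_assoc P,
        compress_star_words hP hPM hx', star_mul, mul_assoc]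
    rw [this]
    exact hy.mul_right hx

/-- The inner P can be dropped: P B^* P A P = (P A P)(P B^* P) = P A B^* P = P B^* A P, by
commutation of the compressions, by P A P = P A and P B^* P = B^* P, and by commutation of A with
B^*. Double commutativity of Q enters the study of the hulls only through this identity. -/
lemma compress_star_mul_words (hP : IsStarProjection P) (hPM : ∀ i, P * M i * P = P * M i)
    (hM : ∀ i j, i ≠ j → Commute (M i) (star (M j)))
    (hC : ∀ i j, i ≠ j → Commute (P * M i * P) (P * star (M j) * P)) {J K : Set ι}
    (hJK : Disjoint J K) {A B : R} (hA : A ∈ words M J) (hB : B ∈ words M K) :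
    P * star B * P * A * P = P * star B * A * P := by
  have hPP : P * P = P := hP.isIdempotentElem
  have h := (commute_compress_words hP hPM hC hJK hA hB).eq
  have h1 := compress_words hP hPM hA
  have h2 := compress_star_words hP hPM hB
  have h3 := (commute_star_words hM hJK hA hB).eq
  calc P * star B * P * A * P = P * star B * (P * P) * A * P := by rw [hPP]
    _ = P * star B * P * (P * A * P) := by noncomm_ring
    _ = P * A * P * (P * star B * P) := h.symm
    _ = P * A * (P * P) * star B * P := by noncomm_ring
    _ = P * A * (P * star B * P) := by rw [hPP]; noncomm_ring
    _ = P * (A * star B) * P := by rw [h2]; noncomm_ring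
    _ = _ := by rw [h3]; noncomm_ring

end Words

/-! ### Subspaces generated from Q by some of the operators, and their projections -/

section Hull

variable {ι H : Type*} [NormedAddCommGroup H] [InnerProductSpace ℂ H]

/-- The closed linear span of the vectors `A q`, where `A` is a product of operators `M j` with
`j ∈ J` and `q ∈ Q`. -/
def hull (M : ι → H →L[ℂ] H) (Q : Submodule ℂ H) (J : Set ι) : Submodule ℂ H :=
  (Submodule.span ℂ {x | ∃ A ∈ words M J, ∃ q ∈ Q, x = A q}).topologicalClosure

variable {M : ι → H →L[ℂ] H} {Q : Submodule ℂ H}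

lemma apply_mem_hull {J : Set ι} {A : H →L[ℂ] H} (hA : A ∈ words M J) {q : H} (hq : q ∈ Q) :
    A q ∈ hull M Q J :=
  Submodule.le_topologicalClosure _ (Submodule.subset_span ⟨A, hA, q, hq, rfl⟩)

lemma le_hull (J : Set ι) : Q ≤ hull M Q J := fun _ hq =>
  apply_mem_hull (one_mem (words M J)) hq

lemma hull_le {J : Set ι} {U : Submodule ℂ H} (hU : IsClosed (U : Set H))
    (h : ∀ A ∈ words M J, ∀ q ∈ Q, A q ∈ U) : hull M Q J ≤ U := by
  refine Submodule.topologicalClosure_minimal _ (Submodule.span_le.2 ?_) hU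
  rintro _ ⟨A, hA, q, hq, rfl⟩
  exact h A hA q hq

lemma isClosed_hull (J : Set ι) : IsClosed (hull M Q J : Set H) :=
  Submodule.isClosed_topologicalClosure _

lemma hull_mono {J K : Set ι} (h : J ⊆ K) : hull M Q J ≤ hull M Q K :=
  hull_le (isClosed_hull K) fun A hA q hq =>
    apply_mem_hull (A := A) (q := q) (words_mono (J := J) (K := K) h hA) hq

lemma mapsTo_hull {J : Set ι} {T : H →L[ℂ] H} {U : Submodule ℂ H} (hU : IsClosed (U : Set H))
    (h : ∀ A ∈ words M J, ∀ q ∈ Q, T (A q) ∈ U) : ∀ x ∈ hull M Q J, T x ∈ U := by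
  have : hull M Q J ≤ U.comap (T : H →ₗ[ℂ] H) :=
    hull_le (hU.preimage T.continuous) h
  exact this

lemma hull_empty (hQ : IsClosed (Q : Set H)) : hull M Q ∅ = Q := by
  refine le_antisymm (hull_le hQ fun A hA q hq => ?_) (le_hull _)
  simp only [words, image_empty, Submonoid.closure_empty, Submonoid.mem_bot] at hA
  simpa [hA] using hq

lemma map_hull {J : Set ι} {A : H →L[ℂ] H} (hA : A ∈ words M J) :
    ∀ x ∈ hull M Q J, A x ∈ hull M Q J :=
  mapsTo_hull (isClosed_hull J) fun _ hB _ hq => apply_mem_hull (mul_mem hA hB) hq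

variable [CompleteSpace H]

/-- T preserves U, and it preserves the orthogonal complement of U because `star T` preserves U. -/
lemma commute_starProjection {U : Submodule ℂ H} [U.HasOrthogonalProjection] {T : H →L[ℂ] H}
    (h : ∀ x ∈ U, T x ∈ U) (h' : ∀ x ∈ U, star T x ∈ U) : Commute U.starProjection T := by
  refine ContinuousLinearMap.ext fun x => ?_
  refine Submodule.eq_starProjection_of_mem_of_inner_eq_zero
    (h _ (U.starProjection_apply_mem x)) fun w hw => ?_
  rw [ContinuousLinearMap.star_eq_adjoint] at h'
  change inner ℂ (T x - T (U.starProjection x)) w = 0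
  rw [← map_sub, ← ContinuousLinearMap.adjoint_inner_right]
  exact U.starProjection_inner_eq_zero _ _ (h' w hw)

instance (J : Set ι) : CompleteSpace (hull M Q J) := by unfold hull; infer_instance

/-- Commuting isometries `M i` such that `M i` commutes with `(M j)^*` for `i ≠ j`. -/
structure IsDoublyCommutingIsometries (M : ι → H →L[ℂ] H) : Prop where
  commute : ∀ i j, Commute (M i) (M j)
  commute_star : ∀ i j, i ≠ j → Commute (M i) (star (M j))
  star_mul_self : ∀ i, star (M i) * M i = 1

/-- Push `star (M i)` through a word from the left: it cancels the first letter if that is `M i`,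
and otherwise commutes past it until it reaches Q, which it preserves. Here i need not belong to J.
-/
lemma star_map_hull (hM : IsDoublyCommutingIsometries M)
    (hQ : ∀ i, ∀ q ∈ Q, star (M i) q ∈ Q) (i : ι) (J : Set ι) :
    ∀ x ∈ hull M Q J, star (M i) x ∈ hull M Q J := by
  refine mapsTo_hull (isClosed_hull J) fun A hA q hq => ?_
  induction hA using Submonoid.closure_induction_left with
  | one => exact le_hull J (hQ i q hq)
  | mul_left x hx y hy ih =>
    obtain ⟨j, hj, rfl⟩ := hx
    by_cases hij : j = i
    · subst hij
      have : star (M j) ((M j * y) q) = y q := by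
        rw [← mul_apply_eq_comp, ← mul_assoc, hM.star_mul_self, one_mul]
      rw [this]
      exact apply_mem_hull hy hq
    · have : star (M i) ((M j * y) q) = M j (star (M i) (y q)) := by
        rw [← mul_apply_eq_comp, ← mul_assoc, ← (hM.commute_star j i hij).eq]
        rfl
      rw [this]
      exact map_hull (A := M j) (mem_words hj) _ ih

lemma commute_hull_generator (hM : IsDoublyCommutingIsometries M)
    (hQ : ∀ i, ∀ q ∈ Q, star (M i) q ∈ Q) {J : Set ι} {i : ι} (hi : i ∈ J) :
    Commute (hull M Q J).starProjection (M i) :=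
  commute_starProjection (map_hull (A := M i) (mem_words hi)) (star_map_hull hM hQ i J)

lemma commute_hull_words (hM : IsDoublyCommutingIsometries M)
    (hQ : ∀ i, ∀ q ∈ Q, star (M i) q ∈ Q) {J : Set ι} {A : H →L[ℂ] H} (hA : A ∈ words M J) :
    Commute (hull M Q J).starProjection A := by
  refine commute_of_mem_closure ?_ hA
  rintro _ ⟨i, hi, rfl⟩
  exact commute_hull_generator hM hQ hi

lemma compress_of_star_map [Q.HasOrthogonalProjection] (hQ : ∀ i, ∀ q ∈ Q, star (M i) q ∈ Q)
    (i : ι) :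
    Q.starProjection * M i * Q.starProjection = Q.starProjection * M i := by
  have h : Q.starProjection * star (M i) * Q.starProjection = star (M i) * Q.starProjection := by
    ext x
    exact Submodule.starProjection_eq_self_iff.2 (hQ i _ (Q.starProjection_apply_mem x))
  have hs : star Q.starProjection = Q.starProjection :=
    (isStarProjection_starProjection (U := Q)).isSelfAdjoint.star_eq
  have := congrArg star h
  simpa [hs, mul_assoc] using this

/-- The difference A q - P A q is orthogonal to every generator B q' of the hull over K, because P
B^* (A q - P A q) = 0 by `compress_star_mul_words`. -/
lemma hull_starProjection_apply [Q.HasOrthogonalProjection] (hM : IsDoublyCommutingIsometries M)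
    (hQ : ∀ i, ∀ q ∈ Q, star (M i) q ∈ Q)
    (hC : ∀ i j, i ≠ j → Commute (Q.starProjection * M i * Q.starProjection)
      (Q.starProjection * star (M j) * Q.starProjection))
    {J K : Set ι} (hJK : Disjoint J K) {A : H →L[ℂ] H} (hA : A ∈ words M J) {q : H} (hq : q ∈ Q) :
    (hull M Q K).starProjection (A q) = Q.starProjection (A q) := by
  refine (Submodule.eq_starProjection_of_mem_of_inner_eq_zero
    (le_hull K (Q.starProjection_apply_mem _)) fun w hw => ?_)
  have hle : hull M Q K ≤ (ℂ ∙ (A q - Q.starProjection (A q)))ᗮ := by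
    refine hull_le (Submodule.isClosed_orthogonal _) fun B hB q' hq' => ?_
    rw [Submodule.mem_orthogonal_singleton_iff_inner_right, ← ContinuousLinearMap.adjoint_inner_left,
      ← ContinuousLinearMap.star_eq_adjoint]
    rw [← Submodule.starProjection_eq_self_iff.2 hq', ← Submodule.inner_starProjection_left_eq_right]
    have h := compress_star_mul_words (isStarProjection_starProjection (U := Q))
      (compress_of_star_map hQ) hM.commute_star hC hJK hA hB
    have h2 := congrArg (fun T : H →L[ℂ] H => T q) h
    simp only [mul_apply_eq_comp, Submodule.starProjection_eq_self_iff.2 hq] at h2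
    rw [map_sub, map_sub, h2, sub_self, inner_zero_left]
  exact Submodule.mem_orthogonal_singleton_iff_inner_right.1 (hle hw)

/-- The projections onto the hulls multiply like the index sets intersect. -/
lemma hull_starProjection_mul [Q.HasOrthogonalProjection] (hM : IsDoublyCommutingIsometries M)
    (hQ : ∀ i, ∀ q ∈ Q, star (M i) q ∈ Q)
    (hC : ∀ i j, i ≠ j → Commute (Q.starProjection * M i * Q.starProjection)
      (Q.starProjection * star (M j) * Q.starProjection)) (K J : Set ι) :
    (hull M Q K).starProjection * (hull M Q J).starProjection
      = (hull M Q (J ∩ K)).starProjection := by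
  have key : ∀ x ∈ hull M Q J, (hull M Q K).starProjection x ∈ hull M Q (J ∩ K) := by
    refine mapsTo_hull (isClosed_hull _) fun A hA q hq => ?_
    -- Split the word as B C, with B in the letters of J ∩ K and C in those of J \ K. The projection
    -- onto the hull over K commutes with B and acts on C q as P does, so the result B (P C q) lies
    -- in the hull over J ∩ K.
    obtain ⟨B, hB, C, hC', rfl⟩ := exists_mul_of_mem_words hM.commute K hA
    have h1 := commute_hull_words hM hQ (words_mono (inter_subset_right (s := J) (t := K)) hB)
    have h2 : (hull M Q K).starProjection ((B * C) q) = B (Q.starProjection (C q)) := by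
      rw [← hull_starProjection_apply hM hQ hC disjoint_sdiff_left hC' hq]
      exact congrArg (fun T : H →L[ℂ] H => T (C q)) h1.eq
    rw [h2]
    exact apply_mem_hull hB (Q.starProjection_apply_mem _)
  -- By `key` the product lands in the smaller hull. A vector w of that hull is fixed by both
  -- projections, so moving them across the inner product gives the orthogonality.
  refine ContinuousLinearMap.ext fun x => ?_
  symm
  refine Submodule.eq_starProjection_of_mem_of_inner_eq_zero
    (key _ (Submodule.starProjection_apply_mem _ _)) fun w hw => ?_
  have hwJ := hull_mono (M := M) (Q := Q) (inter_subset_left (s := J) (t := K)) hw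
  have hwK := hull_mono (M := M) (Q := Q) (inter_subset_right (s := J) (t := K)) hw
  rw [inner_sub_left, mul_apply_eq_comp, Submodule.inner_starProjection_left_eq_right,
    Submodule.starProjection_eq_self_iff.2 hwK, Submodule.inner_starProjection_left_eq_right,
    Submodule.starProjection_eq_self_iff.2 hwJ, sub_self]

/-- The list must be nonempty: the empty product is 1, while the hull over all indices need not be
the whole space (take Q = 0). -/
lemma prod_hull_compl_singleton [Q.HasOrthogonalProjection] (hM : IsDoublyCommutingIsometries M)
    (hQ : ∀ i, ∀ q ∈ Q, star (M i) q ∈ Q)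
    (hC : ∀ i j, i ≠ j → Commute (Q.starProjection * M i * Q.starProjection)
      (Q.starProjection * star (M j) * Q.starProjection)) (l : List ι) (a : ι) :
    ((a :: l).map fun j => (hull M Q {j}ᶜ).starProjection).prod
      = (hull M Q {j | j ∉ a :: l}).starProjection := by
  induction l generalizing a with
  | nil =>
    simp only [List.map_cons, List.map_nil, List.prod_cons, List.prod_nil, mul_one,
      List.mem_singleton]
    rfl
  | cons b l ih =>
    rw [List.map_cons, List.prod_cons, ih b, hull_starProjection_mul hM hQ hC]
    congr 2
    ext j
    simp only [mem_inter_iff, mem_ofPred_eq, mem_compl_iff, mem_singleton_iff, List.mem_cons]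
    tauto

/-- Multiplying by the projection for {j}ᶜ, which is 1, deletes j from the index set; so the
elements of T can be removed one at a time. -/
lemma hull_starProjection_eq_of_forall_eq_one [Q.HasOrthogonalProjection]
    (hM : IsDoublyCommutingIsometries M) (hQ : ∀ i, ∀ q ∈ Q, star (M i) q ∈ Q)
    (hC : ∀ i j, i ≠ j → Commute (Q.starProjection * M i * Q.starProjection)
      (Q.starProjection * star (M j) * Q.starProjection)) (T : Finset ι)
    (hT : ∀ j ∈ T, (hull M Q {j}ᶜ).starProjection = 1) :
    (hull M Q T).starProjection = (hull M Q ∅).starProjection := by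
  classical
  induction T using Finset.induction_on with
  | empty => simp only [Finset.coe_empty]
  | insert j S hj ih =>
    rw [← ih fun k hk => hT k (Finset.mem_insert_of_mem hk)]
    have h := hull_starProjection_mul hM hQ hC {j}ᶜ (insert j S : Finset ι)
    rw [hT j (Finset.mem_insert_self j S), one_mul] at h
    rw [h]
    congr 2
    ext k
    simp only [Finset.coe_insert, mem_inter_iff, mem_insert_iff, mem_compl_iff, mem_singleton_iff,
      Finset.mem_coe]
    refine ⟨fun hk => by tauto, fun hk => ⟨Or.inr hk, fun h => hj (h ▸ hk)⟩⟩

end Hull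
end Abstract

/-! ### Fatou's theorem for bounded holomorphic functions -/

section Fatou

open Metric Asymptotics

/-- On the circle 2 - 2 Re z = ‖z - 1‖², so g(z)/(z - 1) is bounded there by ε + (L/δ²)(2 - 2 Re z),
whether z is near 1 or not. The bound is the real part of a holomorphic function, so the maximum
principle carries it into the disc. -/
lemma norm_le_of_isLittleO_circle {g : ℂ → ℂ} (hg : DiffContOnCl ℂ g (ball 0 1)) {L ε δ : ℝ}
    (hδ : 0 < δ) (hL : ∀ z ∈ sphere (0 : ℂ) 1, ‖g z‖ ≤ L * ‖z - 1‖)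
    (hε : ∀ z ∈ sphere (0 : ℂ) 1, ‖z - 1‖ < δ → ‖g z‖ ≤ ε * ‖z - 1‖) (hε0 : 0 ≤ ε)
    {w : ℂ} (hw : w ∈ ball (0 : ℂ) 1) :
    ‖g w‖ ≤ (ε + L / δ ^ 2 * (2 - 2 * w.re)) * ‖w - 1‖ := by
  have hL0 : 0 ≤ L := by
    have := hL (-1) (by simp)
    have h2 : ‖(-1 - 1 : ℂ)‖ = 2 := by norm_num
    rw [h2] at this
    linarith [norm_nonneg (g (-1))]
  have hne : ∀ η : ℝ, 0 < η → ∀ z ∈ closedBall (0 : ℂ) 1, z - (1 + η) ≠ 0 := by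
    intro η hη z hz h
    have : z = ((1 + η : ℝ) : ℂ) := by push_cast; linear_combination h
    rw [mem_closedBall_zero_iff, this, Complex.norm_real, Real.norm_of_nonneg (by linarith)] at hz
    linarith
  have main : ∀ η : ℝ, 0 < η →
      ‖g w‖ ≤ (ε + L / δ ^ 2 * (2 - 2 * w.re)) * ‖w - (1 + η)‖ := by
    intro η hη
    -- The pole at 1 is moved to 1 + η, outside the closed disc; η tends to 0 at the end.
    set q : ℂ → ℂ := fun z => g z / (z - (1 + η)) with hq
    obtain ⟨u, hu, huq⟩ : ∃ u : ℂ, ‖u‖ = 1 ∧ u * q w = ‖q w‖ := by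
      by_cases h : q w = 0
      · exact ⟨1, by simp, by simp [h]⟩
      · refine ⟨‖q w‖ / q w, ?_, ?_⟩
        · rw [norm_div, Complex.norm_real, norm_norm, div_self (norm_ne_zero_iff.2 h)]
        · field_simp
    -- Exponentiating turns a comparison of real parts into a modulus bound, for which the maximum
    -- principle applies. The unimodular u is chosen so that the real part of u q at w is ‖q w‖.
    set F : ℂ → ℂ := fun z => Complex.exp (u * q z - (ε + (L / δ ^ 2 : ℝ) * (2 - 2 * z))) with hF
    have hqd : DiffContOnCl ℂ q (ball 0 1) := by
      refine ⟨hg.differentiableOn.div (by fun_prop) fun z hz =>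
        hne η hη z (ball_subset_closedBall hz), ?_⟩
      refine hg.continuousOn.div (by fun_prop) fun z hz => hne η hη z ?_
      rwa [closure_ball (0 : ℂ) one_ne_zero] at hz
    have hFd : DiffContOnCl ℂ F (ball 0 1) := by
      refine ⟨?_, ?_⟩
      · have := hqd.differentiableOn
        simp only [hF]; fun_prop
      · have := hqd.continuousOn
        simp only [hF]; fun_prop
    have hbd : ∀ z ∈ frontier (ball (0 : ℂ) 1), ‖F z‖ ≤ 1 := by
      intro z hz
      rw [frontier_ball (0 : ℂ) one_ne_zero] at hz
      rw [hF, Complex.norm_exp]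
      refine Real.exp_le_one_iff.2 ?_
      have hz1 : ‖z‖ = 1 := by simpa using hz
      have hsq : ‖z - 1‖ ^ 2 = 2 - 2 * z.re := by
        rw [Complex.sq_norm, Complex.normSq_apply]
        have := Complex.sq_norm z
        rw [hz1, Complex.normSq_apply] at this
        simp; nlinarith
      have hre : z.re ≤ 1 := by nlinarith [sq_nonneg ‖z - 1‖]
      have hden : ‖z - 1‖ ≤ ‖z - (1 + η)‖ := by
        refine (sq_le_sq₀ (norm_nonneg _) (norm_nonneg _)).1 ?_
        rw [Complex.sq_norm, Complex.normSq_apply, Complex.sq_norm, Complex.normSq_apply]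
        simp; nlinarith
      have hdpos : 0 < ‖z - (1 + η)‖ :=
        norm_pos_iff.2 (hne η hη z (sphere_subset_closedBall hz))
      have hqz : ‖q z‖ ≤ ε + L / δ ^ 2 * (2 - 2 * z.re) := by
        rw [hq, norm_div, div_le_iff₀ hdpos]
        have hc : 0 ≤ L / δ ^ 2 * (2 - 2 * z.re) := mul_nonneg (by positivity) (by linarith)
        by_cases hd : ‖z - 1‖ < δ
        · refine (hε z hz hd).trans ?_
          refine mul_le_mul ?_ hden (norm_nonneg _) (by linarith)
          linarith
        · refine (hL z hz).trans ?_
          refine mul_le_mul ?_ hden (norm_nonneg _) (by linarith)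
          -- Away from 1 one has ‖z - 1‖ ≥ δ, so the second term alone dominates L.
          have : L ≤ L / δ ^ 2 * (2 - 2 * z.re) := by
            rw [← hsq, div_mul_eq_mul_div, le_div_iff₀ (by positivity)]
            gcongr
            linarith
          linarith
      have h1 : (u * q z).re ≤ ‖q z‖ := by
        refine (Complex.re_le_norm _).trans ?_
        rw [norm_mul, hu, one_mul]
      have h2 : ((ε : ℂ) + (L / δ ^ 2 : ℝ) * (2 - 2 * z)).re = ε + L / δ ^ 2 * (2 - 2 * z.re) := by
        rw [Complex.add_re, Complex.re_ofReal_mul]; simp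
      rw [Complex.sub_re, h2]
      linarith
    have hle := Complex.norm_le_of_forall_mem_frontier_norm_le isBounded_ball hFd hbd
      (subset_closure hw)
    rw [hF, Complex.norm_exp, Real.exp_le_one_iff, huq] at hle
    have h2 : ((ε : ℂ) + (L / δ ^ 2 : ℝ) * (2 - 2 * w)).re = ε + L / δ ^ 2 * (2 - 2 * w.re) := by
      rw [Complex.add_re, Complex.re_ofReal_mul]; simp
    rw [Complex.sub_re, h2, Complex.ofReal_re, hq, norm_div, sub_nonpos, div_le_iff₀
      (norm_pos_iff.2 (hne η hη w (ball_subset_closedBall hw)))] at hle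
    exact hle
  have ht : Tendsto (fun η : ℝ => (ε + L / δ ^ 2 * (2 - 2 * w.re)) * ‖w - (1 + η)‖) (𝓝[>] 0)
      (𝓝 ((ε + L / δ ^ 2 * (2 - 2 * w.re)) * ‖w - (1 + (0 : ℝ))‖)) := by
    refine (Continuous.tendsto ?_ 0).mono_left nhdsWithin_le_nhds
    fun_prop
  have := ge_of_tendsto ht (eventually_mem_nhdsWithin.mono fun η hη => main η hη)
  simpa using this

/-- The smallness of g on the circle near 1 extends to the radius by `norm_le_of_isLittleO_circle`;
Cauchy's estimate on the circle of radius (1 - r)/2 about r then makes the derivative small. -/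
lemma tendsto_deriv_zero_of_isLittleO {g : ℂ → ℂ} (hg : DiffContOnCl ℂ g (ball 0 1)) {L : ℝ}
    (hL : ∀ z ∈ sphere (0 : ℂ) 1, ‖g z‖ ≤ L * ‖z - 1‖)
    (ho : g =o[𝓝[sphere 0 1] 1] fun z => z - 1) :
    Tendsto (fun r : ℝ => deriv g r) (𝓝[<] 1) (𝓝 0) := by
  rw [Metric.tendsto_nhds]
  intro ε hε
  -- Near the radius the coefficient is at most ε/16 + ε/16 and ‖z - 1‖ ≤ 2(1 - r). Dividing by the
  -- radius (1 - r)/2 leaves ε/2.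
  have h1 := ho.def (c := ε / 16) (by positivity)
  obtain ⟨δ, hδ, hδ'⟩ := Metric.mem_nhdsWithin_iff.1 h1
  have hbound : ∀ w ∈ ball (0 : ℂ) 1,
      ‖g w‖ ≤ (ε / 16 + L / δ ^ 2 * (2 - 2 * w.re)) * ‖w - 1‖ := fun w hw =>
    norm_le_of_isLittleO_circle hg hδ hL (fun z hz hzd => hδ' ⟨by simpa [dist_eq_norm] using hzd, hz⟩)
      (by positivity) hw
  have hL0 : 0 ≤ L := by
    have := hL (-1) (by simp)
    have h2 : ‖(-1 - 1 : ℂ)‖ = 2 := by norm_num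
    rw [h2] at this
    linarith [norm_nonneg (g (-1))]
  have ht : Tendsto (fun r : ℝ => L / δ ^ 2 * (4 * (1 - r))) (𝓝[<] 1)
      (𝓝 (L / δ ^ 2 * (4 * (1 - 1)))) :=
    (Continuous.tendsto (by fun_prop) 1).mono_left nhdsWithin_le_nhds
  have hsmall : ∀ᶠ r : ℝ in 𝓝[<] 1, L / δ ^ 2 * (4 * (1 - r)) < ε / 16 :=
    ht.eventually_lt_const (by rw [sub_self, mul_zero, mul_zero]; positivity)
  filter_upwards [hsmall, Ioo_mem_nhdsLT (zero_lt_one' ℝ)] with r hr hr01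
  have hr1 : 0 < 1 - r := by linarith [hr01.2]
  have hsub : ball (r : ℂ) (1 - r) ⊆ ball (0 : ℂ) 1 := by
    refine ball_subset_ball' ?_
    rw [dist_zero_right, Complex.norm_real, Real.norm_of_nonneg hr01.1.le]; linarith
  have hbd : ∀ z ∈ sphere (r : ℂ) ((1 - r) / 2), ‖g z‖ ≤ (ε / 8) * (2 * (1 - r)) := by
    intro z hz
    have hzr : ‖z - r‖ = (1 - r) / 2 := by simpa [dist_eq_norm] using hz
    have hzb : z ∈ ball (0 : ℂ) 1 := hsub (by rw [mem_ball, dist_eq_norm, hzr]; linarith)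
    have hz1 : ‖z - 1‖ ≤ 2 * (1 - r) := by
      have : z - 1 = (z - r) + ((r - 1 : ℝ) : ℂ) := by push_cast; ring
      rw [this]
      refine (norm_add_le _ _).trans ?_
      rw [hzr, Complex.norm_real, Real.norm_of_nonpos (by linarith)]; linarith
    have hre : 2 - 2 * z.re ≤ 4 * (1 - r) := by
      have := (abs_le.1 (Complex.abs_re_le_norm (z - 1))).1
      simp at this; linarith
    have hre0 : 0 ≤ 2 - 2 * z.re := by
      have := (abs_le.1 (Complex.abs_re_le_norm z)).2
      have := mem_ball_zero_iff.1 hzb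
      linarith
    refine (hbound z hzb).trans (mul_le_mul ?_ hz1 (norm_nonneg _) (by positivity))
    have : L / δ ^ 2 * (2 - 2 * z.re) ≤ L / δ ^ 2 * (4 * (1 - r)) := by gcongr
    linarith
  have hcb : closedBall (r : ℂ) ((1 - r) / 2) ⊆ ball (r : ℂ) (1 - r) :=
    closedBall_subset_ball (by linarith)
  have hd : DiffContOnCl ℂ g (ball (r : ℂ) ((1 - r) / 2)) :=
    (hg.differentiableOn.mono (hcb.trans hsub)).diffContOnCl_ball le_rfl
  have := Complex.norm_deriv_le_of_forall_mem_sphere_norm_le (by linarith) hd hbd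
  rw [dist_zero_right]
  refine this.trans_lt ?_
  rw [div_lt_iff₀ (by linarith)]
  nlinarith

/-- Differentiability along the circle at ζ gives g a first-order expansion there. Once the affine
part is subtracted, the remainder is o(|z - 1|) on the circle, so its derivative tends to 0 along
the radius. -/
lemma exists_radial_limit_of_differentiableAt {g : ℂ → ℂ} {K : NNReal} (hK : LipschitzWith K g)
    (hg : DifferentiableOn ℂ g (ball 0 1)) {x : ℝ}
    (hx : DifferentiableAt ℝ (fun s : ℝ => g (Complex.exp (2 * Real.pi * s * Complex.I))) x) :
    ∃ c : ℂ, Tendsto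
      (fun r : ℝ => deriv g (r * Complex.exp (2 * Real.pi * x * Complex.I))) (𝓝[<] 1) (𝓝 c) := by
  set e : ℝ → ℂ := fun s => Complex.exp (2 * Real.pi * s * Complex.I) with he
  set ζ : ℂ := e x with hζ
  have hζ1 : ‖ζ‖ = 1 := by
    have : (2 * Real.pi * x * Complex.I : ℂ) = ((2 * Real.pi * x : ℝ) : ℂ) * Complex.I := by
      push_cast; ring
    rw [hζ, he]; simp only; rw [this, Complex.norm_exp_ofReal_mul_I]
  have hζ0 : ζ ≠ 0 := norm_ne_zero_iff.1 (by rw [hζ1]; exact one_ne_zero)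
  have hed : HasDerivAt e (ζ * (2 * Real.pi * Complex.I)) x := by
    have h1 : HasDerivAt (fun s : ℝ => (2 * Real.pi * (s : ℂ) * Complex.I))
        (2 * Real.pi * 1 * Complex.I) x :=
      ((hasDerivAt_id x).ofReal_comp.const_mul (2 * Real.pi : ℂ)).mul_const Complex.I
    simpa using h1.cexp
  obtain ⟨d, hd⟩ : ∃ d, HasDerivAt (fun s => g (e s)) d x := ⟨_, hx.hasDerivAt⟩
  have hpi : (2 * Real.pi * Complex.I : ℂ) ≠ 0 := Complex.two_pi_I_ne_zero
  -- The candidate for the complex derivative at ζ: the derivative along the circle divided by the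
  -- velocity 2πiζ of the parametrization.
  set c : ℂ := d / (ζ * (2 * Real.pi * Complex.I)) with hc
  refine ⟨c, ?_⟩
  have hk : HasDerivAt (fun s => g (e s) - c * e s) 0 x := by
    have := hd.sub (hed.const_mul c)
    have h0 : d - c * (ζ * (2 * Real.pi * Complex.I)) = 0 := by
      rw [hc, div_mul_cancel₀ _ (mul_ne_zero hζ0 hpi), sub_self]
    rwa [h0] at this
  set g₁ : ℂ → ℂ := fun z => g (ζ * z) - g ζ - c * (ζ * z - ζ) with hg₁
  have hmaps : MapsTo (fun z => ζ * z) (ball 0 1) (ball 0 1) := by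
    intro z hz
    simpa [hζ1] using hz
  have hg₁d : DiffContOnCl ℂ g₁ (ball 0 1) := by
    refine ⟨?_, Continuous.continuousOn ?_⟩
    · have : DifferentiableOn ℂ (fun z => g (ζ * z)) (ball 0 1) :=
        hg.comp (by fun_prop) hmaps
      simp only [hg₁]; fun_prop
    · have := hK.continuous
      simp only [hg₁]; fun_prop
  have hL : ∀ z ∈ sphere (0 : ℂ) 1, ‖g₁ z‖ ≤ (K + ‖c‖) * ‖z - 1‖ := by
    intro z _
    have h1 := hK.dist_le_mul (ζ * z) ζ
    have h2 : ζ * z - ζ = ζ * (z - 1) := by ring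
    rw [dist_eq_norm, dist_eq_norm, h2, norm_mul, hζ1, one_mul] at h1
    refine (norm_sub_le _ _).trans ?_
    rw [norm_mul, h2, norm_mul, hζ1, one_mul, add_mul]
    gcongr
  have ho : g₁ =o[𝓝[sphere 0 1] 1] fun z => z - 1 := by
    -- φ is a local inverse of the parametrization, with e(x + φ z) = ζ z on the circle. It is O(z -
    -- 1), being bounded by the logarithm, so a little-o in the parameter becomes a little-o in z -
    -- 1.
    set φ : ℂ → ℝ := fun z => Complex.arg z / (2 * Real.pi) with hφ
    have hargO : φ =O[𝓝 1] fun z : ℂ => z - 1 := by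
      have h1 : DifferentiableAt ℂ Complex.log 1 :=
        Complex.differentiableAt_log (by simp)
      have h2 := h1.isBigO_sub
      simp only [Complex.log_one, sub_zero] at h2
      refine IsBigO.trans ?_ h2
      refine IsBigO.of_bound 1 (Eventually.of_forall fun z => ?_)
      rw [one_mul, hφ, norm_div, Real.norm_of_nonneg (by positivity : (0 : ℝ) ≤ 2 * Real.pi),
        Real.norm_eq_abs, ← Complex.log_im]
      refine (div_le_self (abs_nonneg _) ?_).trans (Complex.abs_im_le_norm _)
      linarith [Real.two_le_pi]
    have hφ0 : Tendsto φ (𝓝 1) (𝓝 0) := by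
      refine hargO.trans_tendsto ?_
      have : Tendsto (fun z : ℂ => z - 1) (𝓝 1) (𝓝 (1 - 1)) := by
        exact Continuous.tendsto (by fun_prop) 1
      simpa using this
    have h3 := (hasDerivAt_iff_isLittleO_nhds_zero.1 hk).comp_tendsto
      (hφ0.mono_left (nhdsWithin_le_nhds (s := sphere (0 : ℂ) 1)))
    have h4 := h3.trans_isBigO (hargO.mono nhdsWithin_le_nhds)
    refine h4.congr' ?_ EventuallyEq.rfl
    filter_upwards [self_mem_nhdsWithin] with z hz
    have hz1 : ‖z‖ = 1 := by simpa using hz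
    have hez : e (x + φ z) = ζ * z := by
      have hpi' : (Real.pi : ℂ) ≠ 0 := by exact_mod_cast Real.pi_ne_zero
      have harg : Complex.exp (Complex.arg z * Complex.I) = z := by
        have := Complex.norm_mul_exp_arg_mul_I z
        rwa [hz1, Complex.ofReal_one, one_mul] at this
      conv_rhs => rw [← harg, hζ, he]
      simp only [he]
      rw [← Complex.exp_add]
      congr 1
      simp only [hφ]
      push_cast
      field_simp
    simp only [Function.comp, hez, smul_zero, sub_zero, hg₁, ← hζ]
    ring
  have hlim := tendsto_deriv_zero_of_isLittleO hg₁d hL ho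
  have hder : ∀ r ∈ Ioo (0 : ℝ) 1, deriv g (r * ζ) = deriv g₁ r / ζ + c := by
    intro r hr
    have hrm : (r : ℂ) ∈ ball (0 : ℂ) 1 := by
      rw [mem_ball_zero_iff, Complex.norm_real, Real.norm_of_nonneg hr.1.le]; exact hr.2
    have h1 : HasDerivAt g (deriv g (ζ * r)) (ζ * r) :=
      (hg.differentiableAt (isOpen_ball.mem_nhds (hmaps hrm))).hasDerivAt
    have h2 : HasDerivAt (fun z => ζ * z) ζ (r : ℂ) := by
      simpa using (hasDerivAt_id (r : ℂ)).const_mul ζ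
    have h3 : HasDerivAt g₁ (deriv g (ζ * r) * ζ - c * ζ) (r : ℂ) :=
      ((h1.comp (r : ℂ) h2).sub_const (g ζ)).sub ((h2.sub_const ζ).const_mul c)
    rw [h3.deriv, mul_comm (r : ℂ)]
    field_simp
    ring
  have hlim' : Tendsto (fun r : ℝ => deriv g₁ r / ζ + c) (𝓝[<] 1) (𝓝 c) := by
    simpa using (hlim.div_const ζ).add_const c
  refine hlim'.congr' ?_
  filter_upwards [Ioo_mem_nhdsLT (zero_lt_one' ℝ)] with r hr
  exact (hder r hr).symm

/-- **Fatou's theorem**: a bounded holomorphic function on the disc has radial limits almost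
everywhere. -/
theorem ae_exists_radial_limit {Θ : ℂ → ℂ} (hΘ : DifferentiableOn ℂ Θ (ball 0 1)) {C : ℝ}
    (hC : ∀ z ∈ ball (0 : ℂ) 1, ‖Θ z‖ ≤ C) :
    ∀ᵐ t ∂(AddCircle.haarAddCircle : Measure UnitAddCircle), ∃ ζ : ℂ,
      Tendsto (fun r : ℝ => Θ ((r : ℂ) * (AddCircle.toCircle t : ℂ))) (𝓝[<] 1) (𝓝 ζ) := by
  -- A primitive G of Θ is Lipschitz because Θ is bounded. It extends to a Lipschitz g on ℂ, whose
  -- restriction to the circle is Lipschitz in the angle and hence differentiable almost everywhere;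
  -- the radial limits of g' = Θ exist at those points.
  obtain ⟨G, hG⟩ := hΘ.isExactOn_ball
  have hLip : LipschitzOnWith C.toNNReal G (ball 0 1) := by
    refine (convex_ball (0 : ℂ) 1).lipschitzOnWith_of_nnnorm_hasDerivWithin_le
      (fun z hz => (hG z hz).hasDerivWithinAt) fun z hz => ?_
    rw [← NNReal.coe_le_coe, coe_nnnorm]
    exact (hC z hz).trans (Real.le_coe_toNNReal C)
  obtain ⟨g, hg, hGg⟩ := hLip.extend_finite_dimension
  have hgd : ∀ z ∈ ball (0 : ℂ) 1, HasDerivAt g (Θ z) z := fun z hz =>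
    (hG z hz).congr_of_eventuallyEq <|
      (eventually_of_mem (isOpen_ball.mem_nhds hz) fun w hw => (hGg hw).symm)
  have heLip : LipschitzWith (2 * Real.pi).toNNReal
      (fun s : ℝ => Complex.exp (2 * Real.pi * s * Complex.I)) := by
    have hd : ∀ x : ℝ, HasDerivAt (fun s : ℝ => Complex.exp (2 * Real.pi * s * Complex.I))
        (Complex.exp (2 * Real.pi * x * Complex.I) * (2 * Real.pi * 1 * Complex.I)) x := fun x =>
      (((hasDerivAt_id x).ofReal_comp.const_mul (2 * Real.pi : ℂ)).mul_const Complex.I).cexp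
    refine lipschitzWith_of_nnnorm_deriv_le (fun x => (hd x).differentiableAt) fun x => ?_
    rw [← NNReal.coe_le_coe, coe_nnnorm, (hd x).deriv, norm_mul,
      Real.coe_toNNReal _ (by positivity)]
    have : (2 * Real.pi * x * Complex.I : ℂ) = ((2 * Real.pi * x : ℝ) : ℂ) * Complex.I := by
      push_cast; ring
    rw [this, Complex.norm_exp_ofReal_mul_I]
    simp [abs_of_pos Real.pi_pos]
  have hae := (hg.comp heLip).ae_differentiableAt_real
  -- Transfers almost every statements from ℝ to the circle by means of the fundamental domain (0,
  -- 1].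
  have hqmp : Measure.QuasiMeasurePreserving
      (fun t : UnitAddCircle => ((AddCircle.measurableEquivIoc 1 0 t : Ioc (0 : ℝ) (0 + 1)) : ℝ))
      (AddCircle.haarAddCircle : Measure UnitAddCircle) volume := by
    have h1 : (AddCircle.haarAddCircle : Measure UnitAddCircle) = volume := by
      rw [AddCircle.volume_eq_smul_haarAddCircle, ENNReal.ofReal_one, one_smul]
    rw [h1]
    refine Measure.QuasiMeasurePreserving.comp (g := Subtype.val)
      (μb := Measure.comap Subtype.val volume) ⟨measurable_subtype_coe, ?_⟩
      (AddCircle.measurePreserving_equivIoc (T := 1) (a := 0)).quasiMeasurePreserving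
    rw [map_comap_subtype_coe measurableSet_Ioc]
    exact Measure.restrict_le_self.absolutelyContinuous
  filter_upwards [hqmp.ae hae] with t ht
  obtain ⟨c, hc⟩ := exists_radial_limit_of_differentiableAt hg
    (fun z hz => (hgd z hz).differentiableAt.differentiableWithinAt) ht
  refine ⟨c, hc.congr' ?_⟩
  filter_upwards [Ioo_mem_nhdsLT (zero_lt_one' ℝ)] with r hr
  have ht' : Complex.exp (2 * Real.pi * ((AddCircle.measurableEquivIoc 1 0 t :
      Ioc (0 : ℝ) (0 + 1)) : ℝ) * Complex.I) = (AddCircle.toCircle t : ℂ) := by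
    have h1 : (((AddCircle.measurableEquivIoc 1 0 t : Ioc (0 : ℝ) (0 + 1)) : ℝ) : UnitAddCircle)
        = t := (AddCircle.measurableEquivIoc 1 0).symm_apply_apply t
    conv_rhs => rw [← h1, AddCircle.toCircle_apply_mk, Circle.coe_exp]
    push_cast; simp
  rw [ht']
  refine (hgd _ ?_).deriv
  rw [mem_ball_zero_iff, norm_mul, norm_toCircle, Complex.norm_real, Real.norm_of_nonneg hr.1.le,
    mul_one]
  exact hr.2

end Fatou

/-! ### Monomials and evaluation functionals -/

namespace HardySpace

variable {n : ℕ}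

/-- The monomials form a Hilbert basis of `H²(𝔻ⁿ)`. -/
noncomputable def basis (n : ℕ) : HilbertBasis (Fin n → ℕ) ℂ (HardySpace n) :=
  HilbertBasis.ofRepr coeffIsometry

lemma basis_apply (α : Fin n → ℕ) (z : polydisc n) : basis n α z = ∏ i, z.1 i ^ α i := by
  classical
  have h : basis n α = synth (lp.single 2 α (1 : ℂ)) := by
    rw [← HilbertBasis.repr_symm_single]; rfl
  rw [h, synth_apply, tsum_eq_single α]
  · simp
  · intro β hβ
    rw [lp.single_apply_ne _ _ _ hβ, zero_mul]

lemma summable_monomial (z : polydisc n) : Summable fun α : Fin n → ℕ => ∏ i, ‖z.1 i‖ ^ α i :=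
  summable_prod_pow fun i => ⟨norm_nonneg _, z.2 i⟩

lemma eq_tsum (f : HardySpace n) (z : polydisc n) :
    f z = ∑' α : Fin n → ℕ, (basis n).repr f α * ∏ i, z.1 i ^ α i := by
  rw [← synth_apply]
  exact congrArg (fun h : HardySpace n => h z) ((basis n).repr.symm_apply_apply f).symm

/-- Taylor coefficients are bounded by ‖f‖ and the monomials are absolutely summable at z. Only
finiteness of the constant matters later. -/
lemma norm_apply_le (f : HardySpace n) (z : polydisc n) :
    ‖f z‖ ≤ (∑' α : Fin n → ℕ, ∏ i, ‖z.1 i‖ ^ α i) * ‖f‖ := by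
  rw [eq_tsum, ← tsum_mul_right]
  refine tsum_of_norm_bounded ((summable_monomial z).mul_right _).hasSum fun α => ?_
  rw [norm_mul, mul_comm, norm_prod]
  simp only [norm_pow]
  gcongr
  rw [← (basis n).repr.norm_map f]
  exact norm_coeffs_le _ α

/-- Evaluation at a point of the polydisc. -/
noncomputable def eval (z : polydisc n) : HardySpace n →L[ℂ] ℂ :=
  LinearMap.mkContinuous
    { toFun := fun f => f z, map_add' := fun _ _ => rfl, map_smul' := fun _ _ => rfl }
    (∑' α : Fin n → ℕ, ∏ i, ‖z.1 i‖ ^ α i) fun f => norm_apply_le f z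

lemma eval_apply (z : polydisc n) (f : HardySpace n) : eval z f = f z := rfl

lemma clm_ext {A B : HardySpace n →L[ℂ] HardySpace n}
    (h : ∀ α, A (basis n α) = B (basis n α)) : A = B := by
  refine ContinuousLinearMap.ext_on
    (Submodule.dense_iff_topologicalClosure_eq_top.2 (basis n).dense_span) ?_
  rintro _ ⟨α, rfl⟩
  exact h α

lemma ext_inner_basis {f g : HardySpace n}
    (h : ∀ α, inner ℂ (basis n α) f = inner ℂ (basis n α) g) : f = g := by
  refine (basis n).repr.injective ?_
  ext α
  rw [HilbertBasis.repr_apply_apply, HilbertBasis.repr_apply_apply, h]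

lemma inner_basis (α β : Fin n → ℕ) :
    inner ℂ (basis n α) (basis n β) = if α = β then (1 : ℂ) else 0 :=
  orthonormal_iff_ite.1 (basis n).orthonormal α β

end HardySpace

/-! ### Multiplication by monomials -/

open HardySpace

variable {n : ℕ}

lemma isHInfty_monomial (α : Fin n → ℕ) :
    IsHInfty (fun z : polydisc n => ∏ i, z.1 i ^ α i) where
  holo := isHolomorphic_of_eqOn (F := fun z => ∏ i, z i ^ α i)
    (by fun_prop : Differentiable ℂ fun z : Fin n → ℂ => ∏ i, z i ^ α i).differentiableOn fun _ => rfl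
  bdd := ⟨1, fun z => by
    rw [norm_prod]
    refine Finset.prod_le_one (fun i _ => norm_nonneg _) fun i _ => ?_
    rw [norm_pow]
    exact pow_le_one₀ (norm_nonneg _) (z.2 i).le⟩

/-- Multiplication by a monomial. -/
noncomputable def mulMonomial (α : Fin n → ℕ) : HardySpace n →L[ℂ] HardySpace n :=
  mulOp _ (isHInfty_monomial α)

lemma mulMonomial_apply (α : Fin n → ℕ) (f : HardySpace n) (z : polydisc n) :
    mulMonomial α f z = (∏ i, z.1 i ^ α i) * f z := rfl

lemma mulMonomial_add (α β : Fin n → ℕ) :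
    mulMonomial (α + β) = mulMonomial α * mulMonomial β := by
  refine ContinuousLinearMap.ext fun f => DFunLike.ext _ _ fun z => ?_
  rw [mul_apply_eq_comp]
  simp only [mulMonomial_apply, Pi.add_apply, pow_add, Finset.prod_mul_distrib, mul_assoc]

lemma mulMonomial_zero : mulMonomial (0 : Fin n → ℕ) = 1 := by
  refine ContinuousLinearMap.ext fun f => DFunLike.ext _ _ fun z => ?_
  simp [mulMonomial_apply]

lemma mulMonomial_single (i : Fin n) : mulMonomial (Pi.single i 1) = mulCoord i := by
  refine ContinuousLinearMap.ext fun f => DFunLike.ext _ _ fun z => ?_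
  have h : ∏ j, z.1 j ^ (Pi.single i 1 : Fin n → ℕ) j = z.1 i := by
    rw [Finset.prod_eq_single i] <;> simp +contextual
  rw [mulMonomial_apply, h]
  rfl

lemma mulMonomial_basis (α β : Fin n → ℕ) : mulMonomial α (basis n β) = basis n (α + β) := by
  refine DFunLike.ext _ _ fun z => ?_
  simp only [mulMonomial_apply, basis_apply, Pi.add_apply, pow_add, Finset.prod_mul_distrib]

lemma inner_star_right (A : HardySpace n →L[ℂ] HardySpace n) (f g : HardySpace n) :
    inner ℂ f (star A g) = inner ℂ (A f) g := by
  rw [ContinuousLinearMap.star_eq_adjoint, ContinuousLinearMap.adjoint_inner_right]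

lemma star_mulMonomial_mul_self (α : Fin n → ℕ) : star (mulMonomial α) * mulMonomial α = 1 := by
  refine clm_ext fun β => ext_inner_basis fun γ => ?_
  rw [mul_apply_eq_comp, inner_star_right]
  simp [mulMonomial_basis, inner_basis]

lemma star_mulMonomial_basis {α β : Fin n → ℕ} (h : ¬ α ≤ β) :
    star (mulMonomial α) (basis n β) = 0 := by
  refine ext_inner_basis fun γ => ?_
  rw [inner_star_right, mulMonomial_basis, inner_basis, if_neg, inner_zero_right]
  rintro rfl
  exact h fun i => by simp

lemma mulMonomial_comm (α β : Fin n → ℕ) : Commute (mulMonomial α) (mulMonomial β) := by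
  rw [commute_iff_eq, ← mulMonomial_add, ← mulMonomial_add, add_comm]

/-- Test on z^γ. If z^β divides z^γ, both products give z^(α + γ - β). If not, z^β does not divide
z^(α + γ) either, since α and β have disjoint supports, and both products vanish. -/
lemma commute_mulMonomial_star {α β : Fin n → ℕ} (h : ∀ i, α i = 0 ∨ β i = 0) :
    Commute (mulMonomial α) (star (mulMonomial β)) := by
  refine clm_ext fun γ => ?_
  rw [mul_apply_eq_comp, mul_apply_eq_comp, mulMonomial_basis]
  by_cases hβ : β ≤ γ
  · obtain ⟨δ, rfl⟩ := exists_add_of_le hβ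
    have key : ∀ δ, star (mulMonomial β) (basis n (β + δ)) = basis n δ := by
      intro δ
      rw [← mulMonomial_basis, ← mul_apply_eq_comp, star_mulMonomial_mul_self]; rfl
    rw [key, add_left_comm, key, mulMonomial_basis]
  · rw [star_mulMonomial_basis hβ, star_mulMonomial_basis, map_zero]
    intro h'
    refine hβ fun i => ?_
    have h1 : β i ≤ α i + γ i := h' i
    change β i ≤ γ i
    rcases h i with h0 | h0 <;> omega

lemma isDoublyCommutingIsometries_mulCoord :
    IsDoublyCommutingIsometries (mulCoord : Fin n → HardySpace n →L[ℂ] HardySpace n) where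
  commute i j := by
    rw [← mulMonomial_single, ← mulMonomial_single]; exact mulMonomial_comm _ _
  commute_star i j hij := by
    rw [← mulMonomial_single, ← mulMonomial_single]
    refine commute_mulMonomial_star fun k => ?_
    by_cases hk : k = i
    · right; subst hk; simp [hij]
    · left; simp [hk]
  star_mul_self i := by
    rw [← mulMonomial_single]; exact star_mulMonomial_mul_self _


/-! ### Submodules depending on one variable -/

section OneVariable

open HardySpace

variable {n : ℕ}

lemma single_one_le {α : Fin n → ℕ} {j : Fin n} (hj : α j ≠ 0) : Pi.single j 1 ≤ α := by
  intro k
  by_cases hk : k = j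
  · subst hk; simp; omega
  · simp [hk]

lemma multiIndex_induction {p : (Fin n → ℕ) → Prop} (zero : p 0)
    (add : ∀ j α, p α → p (Pi.single j 1 + α)) (α : Fin n → ℕ) : p α := by
  induction hm : ∑ j, α j generalizing α with
  | zero =>
    have : α = 0 := by
      ext j
      exact Finset.sum_eq_zero_iff.1 hm j (Finset.mem_univ j)
    rwa [this]
  | succ m ih =>
    obtain ⟨j, hj⟩ : ∃ j, α j ≠ 0 := by
      by_contra! h
      simp [h] at hm
    obtain ⟨β, rfl⟩ := exists_add_of_le (single_one_le hj)
    refine add j β (ih β ?_)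
    simp [Finset.sum_add_distrib] at hm
    omega

/-- Closed subspaces of `H²(𝔻ⁿ)` which are invariant under all `M_{z_j}` and reducing for those with
`j ≠ i`. -/
structure IsReducingExcept (i : Fin n) (S : Submodule ℂ (HardySpace n)) : Prop where
  isClosed : IsClosed (S : Set (HardySpace n))
  map : ∀ j, ∀ f ∈ S, mulCoord j f ∈ S
  star_map : ∀ j, j ≠ i → ∀ f ∈ S, star (mulCoord j) f ∈ S

/-- Unit vectors of `S` orthogonal to `M_{z_i} S` and killed by `M_{z_j}^*` for `j ≠ i`. -/
structure IsWandering (i : Fin n) (S : Submodule ℂ (HardySpace n)) (g : HardySpace n) : Prop where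
  mem : g ∈ S
  norm_eq : ‖g‖ = 1
  star_apply : ∀ j, j ≠ i → star (mulCoord j) g = 0
  inner_eq : ∀ h ∈ S, inner ℂ (mulCoord i h) g = 0

variable {i : Fin n} {S : Submodule ℂ (HardySpace n)} {g : HardySpace n}

lemma mulMonomial_single_add (j : Fin n) (α : Fin n → ℕ) (f : HardySpace n) :
    mulMonomial (Pi.single j 1 + α) f = mulCoord j (mulMonomial α f) := by
  rw [mulMonomial_add, mulMonomial_single, mul_apply_eq_comp]

lemma IsReducingExcept.mulMonomial_mem (hS : IsReducingExcept i S) (α : Fin n → ℕ)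
    {f : HardySpace n} (hf : f ∈ S) : mulMonomial α f ∈ S := by
  induction α using multiIndex_induction with
  | zero => simpa [mulMonomial_zero] using hf
  | add j α ih => rw [mulMonomial_single_add]; exact hS.map j _ ih

lemma IsReducingExcept.star_mulMonomial_mem (hS : IsReducingExcept i S) {α : Fin n → ℕ}
    (hα : α i = 0) {f : HardySpace n} (hf : f ∈ S) : star (mulMonomial α) f ∈ S := by
  induction α using multiIndex_induction generalizing f with
  | zero => simpa [mulMonomial_zero] using hf
  | add j α ih =>
    rw [Pi.add_apply] at hα
    have hj : j ≠ i := by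
      rintro rfl
      simp at hα
    rw [mulMonomial_add, star_mul, mulMonomial_single, mul_apply_eq_comp]
    exact ih (by omega) (hS.star_map j hj f hf)

/-- The projection onto S commutes with multiplication by the variables other than z_i and with the
adjoints, so it is determined by its values on the powers of z_i. The first power with nonzero
projection supplies the wandering vector. -/
lemma IsReducingExcept.exists_isWandering (hS : IsReducingExcept i S) (hne : S ≠ ⊥) :
    ∃ g, IsWandering i S g := by
  classical
  have : CompleteSpace S := hS.isClosed.completeSpace_coe
  set p := S.starProjection with hp
  set x : ℕ → HardySpace n := fun k => basis n (Pi.single i k) with hx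
  have hcomm : ∀ j, j ≠ i → Commute p (mulCoord j) := fun j hj =>
    commute_starProjection (hS.map j) (hS.star_map j hj)
  have hcomm' : ∀ j, j ≠ i → Commute p (star (mulCoord j)) := fun j hj =>
    commute_starProjection (hS.star_map j hj) (by rw [star_star]; exact hS.map j)
  have hmono : ∀ α : Fin n → ℕ, α i = 0 → Commute p (mulMonomial α) := by
    intro α
    induction α using multiIndex_induction with
    | zero => intro _; rw [mulMonomial_zero]; exact Commute.one_right p
    | add j α ih =>
      intro h
      rw [Pi.add_apply] at h
      have hj : j ≠ i := by
        rintro rfl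
        simp at h
      rw [mulMonomial_add, mulMonomial_single]
      exact (hcomm j hj).mul_right (ih (by omega))
  have hex : ∃ k, p (x k) ≠ 0 := by
    by_contra! h
    refine hne (Submodule.eq_bot_iff _ |>.2 fun f hf => ?_)
    have hp0 : p = 0 := by
      refine clm_ext fun α => ?_
      have hα : basis n α = mulMonomial (Function.update α i 0) (x (α i)) := by
        rw [hx, mulMonomial_basis]
        congr 1
        ext j
        by_cases hj : j = i
        · subst hj; simp
        · simp [hj]
      rw [hα, ← mul_apply_eq_comp, (hmono _ (by simp)).eq, mul_apply_eq_comp, h, map_zero]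
      rfl
    rw [← Submodule.starProjection_eq_self_iff.2 hf, ← hp, hp0]
    rfl
  -- Minimality of k gives orthogonality to M_{z_i} S: for h in S, ⟨z_i h, p z_i^k⟩ = ⟨h, z_i^(k-1)⟩
  -- = ⟨h, p z_i^(k-1)⟩ = 0, and for k = 0 the adjoint already kills the constant 1.
  set k := Nat.find hex with hk
  have hk0 : p (x k) ≠ 0 := Nat.find_spec hex
  have hmin : ∀ l < k, p (x l) = 0 := fun l hl => not_not.1 (Nat.find_min hex hl)
  have hstar : ∀ j, j ≠ i → star (mulCoord j) (p (x k)) = 0 := by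
    intro j hj
    rw [← mul_apply_eq_comp, ← (hcomm' j hj).eq, mul_apply_eq_comp, ← mulMonomial_single,
      star_mulMonomial_basis, map_zero]
    intro h
    have := h j
    simp [hj] at this
  have hinner : ∀ h ∈ S, inner ℂ (mulCoord i h) (p (x k)) = 0 := by
    intro h hh
    rw [hp, ← Submodule.inner_starProjection_left_eq_right,
      Submodule.starProjection_eq_self_iff.2 (hS.map i h hh), ← inner_star_right,
      ← mulMonomial_single]
    rcases hk' : k with _ | l
    · rw [star_mulMonomial_basis, inner_zero_right]
      intro h
      have := h i
      simp at this
    · have hl : x (l + 1) = mulMonomial (Pi.single i 1) (x l) := by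
        rw [hx, mulMonomial_basis]
        simp only [← Pi.single_add, add_comm]
      rw [hl, ← mul_apply_eq_comp, star_mulMonomial_mul_self, one_apply_eq_self,
        ← Submodule.starProjection_eq_self_iff.2 hh,
        Submodule.inner_starProjection_left_eq_right, ← hp, hmin l (by omega), inner_zero_right]
  refine ⟨((‖p (x k)‖⁻¹ : ℝ) : ℂ) • p (x k), S.smul_mem _ (S.starProjection_apply_mem _), ?_, ?_, ?_⟩
  · rw [norm_smul, Complex.norm_real, norm_inv, norm_norm, inv_mul_cancel₀ (norm_ne_zero_iff.2 hk0)]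
  · intro j hj
    rw [map_smul, hstar j hj, smul_zero]
  · intro h hh
    rw [inner_smul_right, hinner h hh, mul_zero]

/-- Move one factor z_j to the other side: its adjoint commutes with z^β, as β j = 0, and then kills
g. -/
lemma IsWandering.inner_eq_zero_of_ne (hg : IsWandering i S g) {α β : Fin n → ℕ} {j : Fin n}
    (hj : j ≠ i) (hα : α j ≠ 0) (hβ : β j = 0) :
    inner ℂ (mulMonomial α g) (mulMonomial β g) = 0 := by
  obtain ⟨γ, rfl⟩ := exists_add_of_le (single_one_le hα)
  have hc : Commute (mulMonomial β) (star (mulMonomial (Pi.single j 1))) := by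
    refine commute_mulMonomial_star fun k => ?_
    by_cases hk : k = j
    · left; rw [hk, hβ]
    · right; simp [hk]
  rw [mulMonomial_single_add, ← inner_star_right, ← mulMonomial_single, ← mul_apply_eq_comp,
    ← hc.eq, mul_apply_eq_comp, mulMonomial_single, hg.star_apply j hj, map_zero, inner_zero_right]

/-- If β = 0, then z^α g lies in M_{z_i} S, to which g is orthogonal. Otherwise β contains some
variable z_j, and disjointness forces j ≠ i, so the previous lemma applies with the roles exchanged.
-/
lemma IsWandering.inner_eq_zero_of_disjoint (hS : IsReducingExcept i S) (hg : IsWandering i S g)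
    {α β : Fin n → ℕ} (hd : ∀ j, α j = 0 ∨ β j = 0) (hα : α i ≠ 0) :
    inner ℂ (mulMonomial α g) (mulMonomial β g) = 0 := by
  by_cases hβ : β = 0
  · obtain ⟨γ, rfl⟩ := exists_add_of_le (single_one_le hα)
    rw [hβ, mulMonomial_zero, mulMonomial_single_add, one_apply_eq_self]
    exact hg.inner_eq _ (hS.mulMonomial_mem γ hg.mem)
  · obtain ⟨j, hj⟩ := Function.ne_iff.1 hβ
    have hj' : β j ≠ 0 := hj
    have hαj : α j = 0 := (hd j).resolve_right hj'
    rw [inner_eq_zero_symm]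
    exact hg.inner_eq_zero_of_ne (fun h => hα (h ▸ hαj)) hj' hαj

/-- Multiplication by the common factor z^(α ⊓ β) is isometric, so it can be cancelled; this leaves
exponents with disjoint supports. -/
lemma IsWandering.orthonormal (hS : IsReducingExcept i S) (hg : IsWandering i S g) :
    Orthonormal ℂ fun α : Fin n → ℕ => mulMonomial α g := by
  have hiso : ∀ α (x y : HardySpace n),
      inner ℂ (mulMonomial α x) (mulMonomial α y) = inner ℂ x y := by
    intro α x y
    rw [← inner_star_right, ← mul_apply_eq_comp, star_mulMonomial_mul_self, one_apply_eq_self]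
  refine ⟨fun α => ?_, fun α β hαβ => ?_⟩
  · have h := hiso α g g
    rw [inner_self_eq_norm_sq_to_K, inner_self_eq_norm_sq_to_K, hg.norm_eq] at h
    norm_cast at h
    exact (pow_eq_one_iff_of_nonneg (norm_nonneg _) two_ne_zero).1 (by simpa using h)
  · have hα : α = (α ⊓ β) + (α - β) := by
      ext k; simp only [Pi.add_apply, Pi.inf_apply, Pi.sub_apply]; omega
    have hβ : β = (α ⊓ β) + (β - α) := by
      ext k; simp only [Pi.add_apply, Pi.inf_apply, Pi.sub_apply]; omega
    have e : inner ℂ (mulMonomial α g) (mulMonomial β g)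
        = inner ℂ (mulMonomial (α - β) g) (mulMonomial (β - α) g) := by
      conv_lhs => rw [hα, hβ]
      rw [mulMonomial_add, mulMonomial_add, mul_apply_eq_comp, mul_apply_eq_comp, ← hβ, hiso]
    have hd : ∀ k, (α - β) k = 0 ∨ (β - α) k = 0 := by
      intro k; simp only [Pi.sub_apply]; omega
    obtain ⟨k, hk⟩ := Function.ne_iff.1 hαβ
    have hk' : (α - β) k ≠ 0 ∨ (β - α) k ≠ 0 := by
      simp only [Pi.sub_apply]; omega
    change inner ℂ (mulMonomial α g) (mulMonomial β g) = 0
    rw [e]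
    by_cases hki : k = i
    · subst hki
      rcases hk' with h | h
      · exact hg.inner_eq_zero_of_disjoint hS hd h
      · rw [inner_eq_zero_symm]
        exact hg.inner_eq_zero_of_disjoint hS (fun j => (hd j).symm) h
    · rcases hk' with h | h
      · exact hg.inner_eq_zero_of_ne hki h ((hd k).resolve_left h)
      · rw [inner_eq_zero_symm]
        exact hg.inner_eq_zero_of_ne hki h ((hd k).resolve_right h)

/-- Multiplication by a wandering vector `g` of `S` is an isometry of `H²(𝔻ⁿ)` into `S`. -/
lemma IsWandering.exists_isometry (hS : IsReducingExcept i S) (hg : IsWandering i S g) :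
    ∃ V : HardySpace n →ₗᵢ[ℂ] HardySpace n, (∀ f z, V f z = g z * f z) ∧
      (∀ α, V (basis n α) = mulMonomial α g) ∧ ∀ f, V f ∈ S := by
  have ho := (hg.orthonormal hS).orthogonalFamily
  have hV : ∀ f : HardySpace n,
      HasSum (fun α => (basis n).repr f α • mulMonomial α g)
        (ho.linearIsometry ((basis n).repr f)) := by
    intro f
    simpa using ho.hasSum_linearIsometry ((basis n).repr f)
  have happ : ∀ (f : HardySpace n) z, ho.linearIsometry ((basis n).repr f) z = g z * f z := by
    intro f z
    have h := (eval z).hasSum (hV f)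
    rw [eval_apply] at h
    rw [← h.tsum_eq, eq_tsum f, ← tsum_mul_left]
    refine tsum_congr fun α => ?_
    rw [map_smul, eval_apply, mulMonomial_apply, smul_eq_mul]
    ring
  refine ⟨ho.linearIsometry.comp (basis n).repr.toLinearIsometry, happ, fun α => ?_, fun f => ?_⟩
  · refine DFunLike.ext _ _ fun z => ?_
    refine (happ _ z).trans ?_
    rw [mulMonomial_apply, basis_apply, mul_comm]
  · exact hS.isClosed.mem_of_tendsto (hV f)
      (Eventually.of_forall fun s => S.sum_mem fun α _ => S.smul_mem _ (hS.mulMonomial_mem α hg.mem))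

/-- A closed subspace which is invariant and reducing for all but one coordinate is generated by
any of its wandering vectors. -/
lemma IsWandering.range_eq (hS : IsReducingExcept i S) (hg : IsWandering i S g)
    {V : HardySpace n →ₗᵢ[ℂ] HardySpace n} (hV : ∀ f z, V f z = g z * f z)
    (hVb : ∀ α, V (basis n α) = mulMonomial α g) (hVS : ∀ f, V f ∈ S) :
    V.toLinearMap.range = S := by
  have hle : V.toLinearMap.range ≤ S := by
    rintro _ ⟨f, rfl⟩
    exact hVS f
  have hcl : IsClosed (V.toLinearMap.range : Set (HardySpace n)) := by
    have := V.isometry.isClosedEmbedding.isClosed_range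
    rwa [LinearMap.coe_range]
  have : CompleteSpace V.toLinearMap.range := hcl.completeSpace_coe
  have hVM : ∀ j f, V (mulCoord j f) = mulCoord j (V f) := by
    intro j f
    refine DFunLike.ext _ _ fun z => ?_
    rw [hV, ← mulMonomial_single, mulMonomial_apply, mulMonomial_apply, hV]
    ring
  have hperp : ∀ s : HardySpace n, s ∈ (V.toLinearMap.range)ᗮ ↔
      ∀ α, inner ℂ (mulMonomial α g) s = 0 := by
    intro s
    rw [Submodule.mem_orthogonal]
    refine ⟨fun h α => h _ ⟨basis n α, hVb α⟩, fun h => ?_⟩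
    rintro _ ⟨f, rfl⟩
    have h1 : HasSum (fun α => (basis n).repr f α • V (basis n α)) (V f) := by
      simpa using V.toContinuousLinearMap.hasSum ((basis n).hasSum_repr f)
    have h2 : V f ∈ (ℂ ∙ s)ᗮ := by
      refine (Submodule.isClosed_orthogonal _).mem_of_tendsto h1
        (Eventually.of_forall fun t => Submodule.sum_mem _ fun α _ => Submodule.smul_mem _ _ ?_)
      rw [Submodule.mem_orthogonal_singleton_iff_inner_left, hVb]
      exact h α
    exact Submodule.mem_orthogonal_singleton_iff_inner_left.1 h2
  by_contra hne
  -- If V is not onto S, the orthogonal complement of its range in S is nonzero and again reducing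
  -- except for i, so it contains a wandering vector g'. Then g g' lies in both the range of V and
  -- its complement, although it has norm 1.
  set T := (V.toLinearMap.range)ᗮ ⊓ S with hT
  have hTne : T ≠ ⊥ := by
    intro h
    have := Submodule.sup_orthogonal_inf_of_hasOrthogonalProjection hle
    rw [← hT, h, sup_bot_eq] at this
    exact hne this
  have hTS : IsReducingExcept i T := by
    refine ⟨(Submodule.isClosed_orthogonal _).inter hS.isClosed, ?_, ?_⟩
    · rintro j f ⟨hf, hfS⟩
      refine ⟨(hperp _).2 fun α => ?_, hS.map j f hfS⟩
      -- Orthogonality of z_j f to z^α g has three cases. If α j = 0 and j = i, the adjoint of z^α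
      -- moves past z_i and keeps f in S, while g ⊥ z_i S. If α j = 0 and j ≠ i, the adjoint of z_j
      -- reaches g and kills it. If α j ≠ 0, a common factor z_j cancels.
      by_cases hα : α j = 0
      · by_cases hj : j = i
        · subst hj
          have hc : Commute (mulCoord j) (star (mulMonomial α)) := by
            rw [← mulMonomial_single]
            refine commute_mulMonomial_star fun k => ?_
            by_cases hk : k = j
            · right; rw [hk, hα]
            · left; simp [hk]
          rw [← inner_star_right, ← mul_apply_eq_comp, ← hc.eq, mul_apply_eq_comp,
            inner_eq_zero_symm]
          exact hg.inner_eq _ (hS.star_mulMonomial_mem hα hfS)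
        · have hc : Commute (mulMonomial α) (star (mulCoord j)) := by
            rw [← mulMonomial_single]
            refine commute_mulMonomial_star fun k => ?_
            by_cases hk : k = j
            · left; rw [hk, hα]
            · right; simp [hk]
          rw [inner_eq_zero_symm, ← inner_star_right, ← mul_apply_eq_comp, ← hc.eq,
            mul_apply_eq_comp, hg.star_apply j hj, map_zero, inner_zero_right]
      · obtain ⟨γ, rfl⟩ := exists_add_of_le (single_one_le hα)
        rw [mulMonomial_single_add, ← inner_star_right, ← mul_apply_eq_comp, ← mulMonomial_single,
          star_mulMonomial_mul_self, one_apply_eq_self]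
        exact (hperp f).1 hf γ
    · rintro j hj f ⟨hf, hfS⟩
      refine ⟨(Submodule.mem_orthogonal _ _).2 ?_, hS.star_map j hj f hfS⟩
      rintro _ ⟨h, rfl⟩
      rw [inner_star_right]
      change inner ℂ (mulCoord j (V h)) f = 0
      rw [← hVM]
      exact (Submodule.mem_orthogonal _ _).1 hf _ ⟨_, rfl⟩
  obtain ⟨g', hg'⟩ := hTS.exists_isWandering hTne
  obtain ⟨W, hW, -, hWT⟩ := hg'.exists_isometry hTS
  have hWg : W g = V g' := by
    refine DFunLike.ext _ _ fun z => ?_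
    rw [hW, hV, mul_comm]
  have h0 : inner ℂ (V g') (W g) = 0 := (Submodule.mem_orthogonal _ _).1 (hWT g).1 _ ⟨_, rfl⟩
  rw [hWg, inner_self_eq_zero] at h0
  have h1 := V.norm_map g'
  rw [h0, hg'.norm_eq, norm_zero] at h1
  exact zero_ne_one h1

end OneVariable

/-! ### Beurling's theorem -/

section Beurling

open HardySpace

variable {n : ℕ} {i : Fin n} {S : Submodule ℂ (HardySpace n)} {g : HardySpace n}

/-- A function on the polydisc which multiplies `H²` isometrically is bounded by `1`. -/
lemma norm_apply_le_one_of_isometry {V : HardySpace n →ₗᵢ[ℂ] HardySpace n}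
    (hV : ∀ f z, V f z = g z * f z) (z : polydisc n) : ‖g z‖ ≤ 1 := by
  -- Iterating the isometry on 1 gives functions g^k of norm 1. Evaluation at z is bounded, so the
  -- powers of ‖g z‖ stay bounded.
  have hpow : ∀ k : ℕ, ∃ f : HardySpace n, ‖f‖ = 1 ∧ f z = g z ^ k := by
    intro k
    induction k with
    | zero => exact ⟨basis n 0, (basis n).orthonormal.1 0, by simp [basis_apply]⟩
    | succ k ih =>
      obtain ⟨f, hf, hfz⟩ := ih
      exact ⟨V f, by rw [V.norm_map, hf], by rw [hV, hfz, pow_succ']⟩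
  by_contra! h
  obtain ⟨k, hk⟩ := ((tendsto_pow_atTop_atTop_of_one_lt h).eventually_gt_atTop
    (∑' α : Fin n → ℕ, ∏ i, ‖z.1 i‖ ^ α i)).exists
  obtain ⟨f, hf, hfz⟩ := hpow k
  have := norm_apply_le f z
  rw [hf, hfz, mul_one, norm_pow] at this
  linarith

lemma single_mem_polydisc (i : Fin n) {w : ℂ} (hw : w ∈ Metric.ball (0 : ℂ) 1) :
    Pi.single i w ∈ polydisc n := by
  intro j
  by_cases hj : j = i
  · subst hj; simpa using hw
  · simp [hj]

/-- The function of one variable `w ↦ g(0, …, w, …, 0)`, with `w` in position `i`. -/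
noncomputable def slice (i : Fin n) (g : HardySpace n) : ℂ → ℂ :=
  fun w => extendZero g (Pi.single i w)

lemma slice_apply (g : HardySpace n) {w : ℂ} (hw : w ∈ Metric.ball (0 : ℂ) 1) :
    slice i g w = g ⟨Pi.single i w, single_mem_polydisc i hw⟩ :=
  extendZero_of_mem _ _

lemma differentiableOn_slice (i : Fin n) (g : HardySpace n) :
    DifferentiableOn ℂ (slice i g) (Metric.ball 0 1) := by
  refine g.holo.comp (Differentiable.differentiableOn ?_) fun w hw => single_mem_polydisc i hw
  refine differentiable_pi.mpr fun j => ?_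
  by_cases hj : j = i
  · subst hj; simp only [Pi.single_eq_same]; exact differentiable_id
  · simp only [Pi.single_eq_of_ne hj]; exact differentiable_const 0

/-- A vanishing adjoint of M_{z_j} kills every Taylor coefficient whose monomial contains z_j, so g
is a function of z_i alone. -/
lemma slice_eq (hg : ∀ j, j ≠ i → star (mulCoord j) g = 0) (z : polydisc n) :
    slice i g (z.1 i) = g z := by
  rw [slice_apply g (mem_ball_zero_iff.2 (z.2 i)), eq_tsum, eq_tsum]
  refine tsum_congr fun α => ?_
  by_cases h : ∃ j, j ≠ i ∧ α j ≠ 0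
  · obtain ⟨j, hj, hα⟩ := h
    have h0 : (basis n).repr g α = 0 := by
      obtain ⟨γ, rfl⟩ := exists_add_of_le (single_one_le hα)
      rw [HilbertBasis.repr_apply_apply, ← mulMonomial_basis, mulMonomial_single,
        ← inner_star_right, hg j hj, inner_zero_right]
    rw [h0, zero_mul, zero_mul]
  · push Not at h
    congr 1
    refine Finset.prod_congr rfl fun j _ => ?_
    by_cases hj : j = i
    · subst hj; simp
    · rw [h j hj, pow_zero, pow_zero]

lemma meanSq_eq_integral_slice (hg : ∀ j, j ≠ i → star (mulCoord j) g = 0) {r : ℝ}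
    (hr : r ∈ Ico (0 : ℝ) 1) :
    meanSq (extendZero g) r =
      ∫ t : UnitAddCircle, ‖slice i g (r * (AddCircle.toCircle t : ℂ))‖ ^ 2
        ∂AddCircle.haarAddCircle := by
  have hmp := measurePreserving_eval
    (fun _ : Fin n => (AddCircle.haarAddCircle : Measure UnitAddCircle)) i
  have hc : Continuous fun t : UnitAddCircle =>
      ‖slice i g (r * (AddCircle.toCircle t : ℂ))‖ ^ 2 := by
    refine ((differentiableOn_slice i g).continuousOn.comp_continuous ?_ fun t => ?_).norm.pow 2
    · exact continuous_const.mul (continuous_subtype_val.comp AddCircle.continuous_toCircle)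
    · rw [mem_ball_zero_iff, norm_mul, norm_toCircle, mul_one, Complex.norm_real,
        Real.norm_of_nonneg hr.1]
      exact hr.2
  rw [← hmp.map_eq, integral_map hmp.measurable.aemeasurable hc.aestronglyMeasurable]
  refine integral_congr_ae (Eventually.of_forall fun t => ?_)
  have hm := torusPoint_mem (fun _ => hr) t
  simp only [Function.eval]
  rw [extendZero_of_mem _ hm, ← slice_eq hg ⟨_, hm⟩]
  rfl

/-- By Parseval the mean is a power series in r with nonnegative coefficients. -/
lemma meanSq_mono {F : (Fin n → ℂ) → ℂ} (hF : DifferentiableOn ℂ F (polydisc n)) {r s : ℝ}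
    (hr : 0 ≤ r) (hrs : r ≤ s) (hs : s < 1) : meanSq F r ≤ meanSq F s := by
  refine hasSum_le (fun k => ?_)
    (hasSum_taylor_sq hF (r := fun _ => r) fun _ => ⟨hr, hrs.trans_lt hs⟩)
    (hasSum_taylor_sq hF (r := fun _ => s) fun _ => ⟨hr.trans hrs, hs⟩)
  have h0 : 0 ≤ ∏ i, r ^ k i := Finset.prod_nonneg fun i _ => pow_nonneg hr _
  gcongr

/-- The radial limits ζ exist by Fatou's theorem and satisfy |ζ| ≤ 1. By dominated convergence the
mean of |ζ|² is the limit of the means over circles, which is at least ‖g‖² = 1; hence |ζ| = 1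
almost everywhere. -/
lemma isInner_slice (hg : ∀ j, j ≠ i → star (mulCoord j) g = 0) (hnorm : ‖g‖ = 1)
    (hle : ∀ z, ‖g z‖ ≤ 1) : IsInner (slice i g) := by
  have hb : ∀ w ∈ Metric.ball (0 : ℂ) 1, ‖slice i g w‖ ≤ 1 := fun w hw => by
    rw [slice_apply g hw]; exact hle _
  refine ⟨differentiableOn_slice i g, ⟨1, hb⟩, ?_⟩
  have hae := ae_exists_radial_limit (differentiableOn_slice i g) hb
  have hmem : ∀ (t : UnitAddCircle), ∀ᶠ r : ℝ in 𝓝[<] 1,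
      (r : ℂ) * (AddCircle.toCircle t : ℂ) ∈ Metric.ball (0 : ℂ) 1 := by
    intro t
    filter_upwards [Ioo_mem_nhdsLT (zero_lt_one' ℝ)] with r hr
    rw [mem_ball_zero_iff, norm_mul, norm_toCircle, mul_one, Complex.norm_real,
      Real.norm_of_nonneg hr.1.le]
    exact hr.2
  choose! ζ hζ using fun (t : UnitAddCircle)
    (h : ∃ ζ : ℂ, Tendsto (fun r : ℝ => slice i g ((r : ℂ) * (AddCircle.toCircle t : ℂ)))
      (𝓝[<] 1) (𝓝 ζ)) => h
  have hζ1 : ∀ᵐ t ∂(AddCircle.haarAddCircle : Measure UnitAddCircle), ‖ζ t‖ ≤ 1 := by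
    filter_upwards [hae] with t ht
    exact le_of_tendsto (hζ t ht).norm ((hmem t).mono fun r hr => hb _ hr)
  have hcont : ∀ r ∈ Ioo (0 : ℝ) 1, Continuous fun t : UnitAddCircle =>
      slice i g (r * (AddCircle.toCircle t : ℂ)) := by
    intro r hr
    refine (differentiableOn_slice i g).continuousOn.comp_continuous ?_ fun t => ?_
    · exact continuous_const.mul (continuous_subtype_val.comp AddCircle.continuous_toCircle)
    · rw [mem_ball_zero_iff, norm_mul, norm_toCircle, mul_one, Complex.norm_real,
        Real.norm_of_nonneg hr.1.le]
      exact hr.2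
  have hlim : Tendsto (fun r : ℝ => ∫ t : UnitAddCircle,
      ‖slice i g (r * (AddCircle.toCircle t : ℂ))‖ ^ 2 ∂AddCircle.haarAddCircle) (𝓝[<] 1)
      (𝓝 (∫ t : UnitAddCircle, ‖ζ t‖ ^ 2 ∂AddCircle.haarAddCircle)) := by
    refine tendsto_integral_filter_of_dominated_convergence (fun _ => (1 : ℝ)) ?_ ?_
      (integrable_const _) ?_
    · filter_upwards [Ioo_mem_nhdsLT (zero_lt_one' ℝ)] with r hr
      exact ((hcont r hr).norm.pow 2).aestronglyMeasurable
    · filter_upwards [Ioo_mem_nhdsLT (zero_lt_one' ℝ)] with r hr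
      refine Eventually.of_forall fun t => ?_
      rw [norm_pow, norm_norm]
      refine pow_le_one₀ (norm_nonneg _) (hb _ ?_)
      rw [mem_ball_zero_iff, norm_mul, norm_toCircle, mul_one, Complex.norm_real,
        Real.norm_of_nonneg hr.1.le]
      exact hr.2
    · filter_upwards [hae] with t ht
      exact (hζ t ht).norm.pow 2
  -- ζ comes from a choice and has no measurability of its own; |ζ|² is an almost everywhere limit
  -- of continuous functions along a sequence of radii.
  have hζm : AEStronglyMeasurable (fun t => ‖ζ t‖ ^ 2)
      (AddCircle.haarAddCircle : Measure UnitAddCircle) := by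
    obtain ⟨u, -, hu, hut⟩ := exists_seq_strictMono_tendsto' (zero_lt_one' ℝ)
    have hut' : Tendsto u atTop (𝓝[<] 1) :=
      tendsto_nhdsWithin_iff.2 ⟨hut, Eventually.of_forall fun k => (hu k).2⟩
    refine aestronglyMeasurable_of_tendsto_ae atTop
      (fun k => ((hcont (u k) (hu k)).norm.pow 2).aestronglyMeasurable) ?_
    filter_upwards [hae] with t ht
    exact ((hζ t ht).norm.pow 2).comp hut'
  have hζi : Integrable (fun t => ‖ζ t‖ ^ 2)
      (AddCircle.haarAddCircle : Measure UnitAddCircle) := by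
    refine Integrable.of_bound hζm 1 ?_
    filter_upwards [hζ1] with t ht
    rw [norm_pow, norm_norm]
    exact pow_le_one₀ (norm_nonneg _) ht
  have hge : 1 ≤ ∫ t : UnitAddCircle, ‖ζ t‖ ^ 2 ∂AddCircle.haarAddCircle := by
    have h1 : sSup (meanSq (extendZero g) '' Ico 0 1) = 1 := by
      rw [HardySpace.norm_def] at hnorm
      exact Real.sqrt_eq_one.1 hnorm
    refine h1.symm.le.trans ?_
    refine csSup_le ⟨_, 0, by norm_num, rfl⟩ ?_
    rintro _ ⟨r, hr, rfl⟩
    refine ge_of_tendsto hlim ?_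
    filter_upwards [Ioo_mem_nhdsLT hr.2] with s hs
    rw [← meanSq_eq_integral_slice hg ⟨hr.1.trans hs.1.le, hs.2⟩]
    exact meanSq_mono g.holo hr.1 hs.1.le hs.2
  have hnonneg : 0 ≤ᵐ[(AddCircle.haarAddCircle : Measure UnitAddCircle)]
      fun t => 1 - ‖ζ t‖ ^ 2 := by
    filter_upwards [hζ1] with t ht
    exact sub_nonneg.2 (pow_le_one₀ (norm_nonneg _) ht)
  have hzero : ∫ t : UnitAddCircle, (1 - ‖ζ t‖ ^ 2) ∂AddCircle.haarAddCircle = 0 := by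
    refine le_antisymm ?_ (integral_nonneg_of_ae hnonneg)
    rw [integral_sub (integrable_const _) hζi]
    simpa using hge
  have hone := (integral_eq_zero_iff_of_nonneg_ae hnonneg ((integrable_const _).sub hζi)).1 hzero
  filter_upwards [hae, hone] with t ht ht1
  refine ⟨ζ t, ?_, hζ t ht⟩
  have : ‖ζ t‖ ^ 2 = 1 := by
    have h : 1 - ‖ζ t‖ ^ 2 = 0 := ht1
    linarith
  exact (pow_eq_one_iff_of_nonneg (norm_nonneg _) two_ne_zero).1 this

/-- **Beurling's theorem** in one of several variables. -/
theorem IsReducingExcept.exists_isInner [S.HasOrthogonalProjection] (hS : IsReducingExcept i S)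
    (hne : S ≠ ⊥) : ∃ (Θ : ℂ → ℂ) (hΘ : IsInner Θ), (mulInner hΘ i).range = S ∧
      mulInner hΘ i * star (mulInner hΘ i) = S.starProjection := by
  obtain ⟨g, hg⟩ := hS.exists_isWandering hne
  obtain ⟨V, hV, hVb, hVS⟩ := hg.exists_isometry hS
  have hΘ := isInner_slice hg.star_apply hg.norm_eq (norm_apply_le_one_of_isometry hV)
  have hMV : ∀ f, mulInner hΘ i f = V f := by
    intro f
    refine DFunLike.ext _ _ fun z => ?_
    rw [hV, ← slice_eq hg.star_apply z]
    rfl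
  have hrange : (mulInner hΘ i).range = S := by
    rw [← hg.range_eq hS hV hVb hVS]
    ext f
    simp [hMV]
  refine ⟨slice i g, hΘ, hrange, ?_⟩
  refine ContinuousLinearMap.ext fun f => ?_
  symm
  refine Submodule.eq_starProjection_of_mem_of_inner_eq_zero (K := S) ?_ fun w hw => ?_
  · rw [← hrange]
    exact ⟨_, rfl⟩
  · rw [← hrange] at hw
    obtain ⟨h, rfl⟩ := hw
    change inner ℂ (f - mulInner hΘ i (star (mulInner hΘ i) f)) (mulInner hΘ i h) = 0
    rw [inner_sub_left, hMV (star (mulInner hΘ i) f), hMV h, V.inner_map_map,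
      ContinuousLinearMap.star_eq_adjoint, ContinuousLinearMap.adjoint_inner_left, hMV, sub_self]

end Beurling

/-! ### Doubly commuting quotient modules -/

section Quotient

variable {n : ℕ} {Q : ClosedSubmodule ℂ (HardySpace n)}

lemma IsQuotientModule.star_mulCoord_mem (hQ : IsQuotientModule Q) (i : Fin n) :
    ∀ q ∈ Q.toSubmodule, star (mulCoord i) q ∈ Q.toSubmodule := by
  intro q hq
  rw [← Submodule.orthogonal_orthogonal Q.toSubmodule]
  intro f hf
  rw [inner_star_right]
  exact Submodule.inner_left_of_mem_orthogonal hq (hQ i f hf)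

lemma subtypeL_comp_compression_comp (i : Fin n) :
    Q.toSubmodule.subtypeL ∘L compression Q i ∘L Q.toSubmodule.orthogonalProjectionOnto
      = Q.toSubmodule.starProjection * mulCoord i * Q.toSubmodule.starProjection := rfl

lemma subtypeL_comp_adjoint_compression_comp (i : Fin n) :
    Q.toSubmodule.subtypeL ∘L (compression Q i).adjoint ∘L
        Q.toSubmodule.orthogonalProjectionOnto
      = Q.toSubmodule.starProjection * star (mulCoord i) * Q.toSubmodule.starProjection := by
  rw [compression, ContinuousLinearMap.adjoint_comp, ContinuousLinearMap.adjoint_comp,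
    Submodule.adjoint_subtypeL, Submodule.adjoint_orthogonalProjectionOnto]
  rfl

/-- Rewrites the commutation of operators on Q as one of operators P T P on the whole space, the
form used for the hulls, and removes the restriction i < j. -/
lemma IsDoublyCommuting.commute (hQ : IsDoublyCommuting Q) (i j : Fin n) (hij : i ≠ j) :
    Commute (Q.toSubmodule.starProjection * mulCoord i * Q.toSubmodule.starProjection)
      (Q.toSubmodule.starProjection * star (mulCoord j) * Q.toSubmodule.starProjection) := by
  set P := Q.toSubmodule.starProjection with hP
  have hs : star P = P := (isStarProjection_starProjection (U := Q.toSubmodule)).isSelfAdjoint.star_eq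
  have hlt : ∀ i j : Fin n, i < j → Commute (P * mulCoord i * P) (P * star (mulCoord j) * P) := by
    intro i j hij
    have h := hQ.comm i j hij
    have hpt : ∀ x : Q.toSubmodule, Q.toSubmodule.orthogonalProjectionOnto (x : HardySpace n) = x :=
      fun x => Submodule.orthogonalProjectionOnto_mem_subspace_eq_self x
    rw [← subtypeL_comp_compression_comp, ← subtypeL_comp_adjoint_compression_comp]
    refine ContinuousLinearMap.ext fun x => ?_
    have h1 := congrArg (fun T => ((T (Q.toSubmodule.orthogonalProjectionOnto x)) : HardySpace n)) h
    simpa [hpt] using h1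
  rcases lt_or_gt_of_ne hij with h | h
  · exact hlt i j h
  -- For j < i, take adjoints in the relation for the pair (j, i).
  · have := (hlt j i h).star_star
    have e : ∀ A : HardySpace n →L[ℂ] HardySpace n, star (P * A * P) = P * star A * P := by
      intro A; simp [hs, mul_assoc]
    rw [e, e, star_star] at this
    exact this.symm

/-- Telescoping: x - A B x = (x - B x) + (B x - A (B x)). It decomposes vectors killed by a product
of projections into finite sums, without taking closures. -/
lemma sub_prod_apply_mem {H : Type*} [NormedAddCommGroup H] [InnerProductSpace ℂ H]
    {R : Submodule ℂ H} {l : List (H →L[ℂ] H)} (h : ∀ A ∈ l, ∀ x, x - A x ∈ R) (x : H) :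
    x - l.prod x ∈ R := by
  induction l with
  | nil => simp
  | cons A l ih =>
    have h1 := ih fun B hB => h B (List.mem_cons_of_mem A hB)
    have h2 := h A List.mem_cons_self (l.prod x)
    rw [List.prod_cons, mul_apply_eq_comp]
    simpa using R.add_mem h1 h2

end Quotient
end PolydiscHardy
-- The main theorem
open PolydiscHardy in
theorem corollary4p2 (n : ℕ) (hn : 1 ≤ n) (Q : ClosedSubmodule ℂ (HardySpace n))
    (hQ : IsDoublyCommuting Q) (hQtop : Q ≠ ⊤) :
    ∃ m ∈ Finset.Icc 1 n, ∃ i : Fin m → Fin n, StrictMono i ∧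
      ∃ (Θ : Fin m → ℂ → ℂ) (hΘ : ∀ j, IsInner (Θ j)),
        Q.orthogonal.toSubmodule = ⨆ j, (mulInner (hΘ j) (i j)).range ∧
        (∀ j l, Commute (1 - mulInner (hΘ j) (i j) * (mulInner (hΘ j) (i j)).adjoint)
          (1 - mulInner (hΘ l) (i l) * (mulInner (hΘ l) (i l)).adjoint)) ∧
        Q.toSubmodule.starProjection =
          (List.ofFn fun j => 1 - mulInner (hΘ j) (i j) * (mulInner (hΘ j) (i j)).adjoint).prod ∧
        Q.orthogonal.toSubmodule.starProjection =
          1 - (List.ofFn fun j =>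
            1 - mulInner (hΘ j) (i j) * (mulInner (hΘ j) (i j)).adjoint).prod := by
  classical
  have hM := isDoublyCommutingIsometries_mulCoord (n := n)
  have hQs := hQ.isQuotientModule.star_mulCoord_mem
  have hC := hQ.commute
  set p : Set (Fin n) → HardySpace n →L[ℂ] HardySpace n := fun J =>
    (hull mulCoord Q.toSubmodule J).starProjection with hp
  have hmul : ∀ K J, p K * p J = p (J ∩ K) := hull_starProjection_mul hM hQs hC
  have hempty : p ∅ = Q.toSubmodule.starProjection := by
    simp only [hp, hull_empty Q.isClosed']
  have hfin : ∀ T : Finset (Fin n), (∀ j ∈ T, p {j}ᶜ = 1) →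
      p T = Q.toSubmodule.starProjection := fun T hT =>
    (hull_starProjection_eq_of_forall_eq_one hM hQs hC T hT).trans hempty
  -- The coordinates that carry an inner function are those whose hull over {i}ᶜ is a proper
  -- subspace.
  set I : Finset (Fin n) := Finset.univ.filter fun i => p {i}ᶜ ≠ 1 with hI
  have hInot : ∀ j, j ∉ I → p {j}ᶜ = 1 := by
    intro j hj
    simpa [hI] using hj
  have hIne : I.Nonempty := by
    by_contra hne
    rw [Finset.not_nonempty_iff_eq_empty] at hne
    have hall : ∀ j, p {j}ᶜ = 1 := fun j => hInot j (by simp [hne])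
    -- If I were empty, deleting every index but 0 would give p {0}ᶜ = P, while p {0}ᶜ = 1, so Q
    -- would be everything. This is where n ≥ 1 is needed.
    have h1 := hfin (Finset.univ.erase ⟨0, hn⟩) fun j _ => hall j
    have h2 : ((Finset.univ.erase ⟨0, hn⟩ : Finset (Fin n)) : Set (Fin n)) = {⟨0, hn⟩}ᶜ := by
      ext j; simp
    rw [h2, hall] at h1
    refine hQtop (ClosedSubmodule.toSubmodule_injective ?_)
    refine (Submodule.eq_top_iff' (p := Q.toSubmodule)).2 fun x => ?_
    rw [← Submodule.starProjection_eq_self_iff, ← h1]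
    rfl
  have hbeur : ∀ i ∈ I, ∃ (Θ : ℂ → ℂ) (hΘ : IsInner Θ),
      (mulInner hΘ i).range = (hull mulCoord Q.toSubmodule {i}ᶜ)ᗮ ∧
      1 - mulInner hΘ i * (mulInner hΘ i).adjoint = p {i}ᶜ := by
    intro i hi
    set E := hull mulCoord Q.toSubmodule {i}ᶜ with hE
    -- By duality: E is invariant under every adjoint, so its complement is invariant under every
    -- M_{z_j}; E is invariant under M_{z_j} for j ≠ i, so its complement is invariant under those
    -- adjoints.
    have hS : IsReducingExcept i Eᗮ := by
      refine ⟨Submodule.isClosed_orthogonal _, fun j f hf => ?_, fun j hj f hf => ?_⟩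
      · intro e he
        rw [← inner_eq_zero_symm, ← inner_star_right, inner_eq_zero_symm]
        exact hf _ (star_map_hull hM hQs j _ e he)
      · intro e he
        rw [inner_star_right]
        exact hf _ (map_hull (A := mulCoord j) (mem_words hj) e he)
    have hne : Eᗮ ≠ ⊥ := by
      intro h
      rw [Submodule.orthogonal_eq_bot_iff] at h
      refine (Finset.mem_filter.1 hi).2 ?_
      refine ContinuousLinearMap.ext fun x => ?_
      exact Submodule.starProjection_eq_self_iff.2 (hE ▸ h ▸ Submodule.mem_top)
    obtain ⟨Θ, hΘ, hr, hproj⟩ := hS.exists_isInner hne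
    refine ⟨Θ, hΘ, hr, ?_⟩
    rw [← ContinuousLinearMap.star_eq_adjoint, hproj, Submodule.starProjection_orthogonal',
      sub_sub_cancel]
  choose! Θ hΘ hr hproj using hbeur
  set idx := I.orderEmbOfFin rfl with hidx
  have hmem : ∀ j, idx j ∈ I := fun j => I.orderEmbOfFin_mem rfl j
  refine ⟨I.card, Finset.mem_Icc.2 ⟨hIne.card_pos, (Finset.card_le_univ I).trans (by simp)⟩,
    idx, idx.strictMono, fun j => Θ (idx j), fun j => hΘ _ (hmem j), ?_⟩
  simp only [fun j => hproj (idx j) (hmem j), fun j => hr (idx j) (hmem j)]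
  have hprod : (List.ofFn fun j => p {idx j}ᶜ).prod = Q.toSubmodule.starProjection := by
    have h1 : (List.ofFn fun j => p {idx j}ᶜ) = (List.ofFn idx).map fun i => p {i}ᶜ := by
      rw [List.map_ofFn]; rfl
    have h2 : ∀ k, k ∈ List.ofFn idx ↔ k ∈ I := by
      intro k
      rw [List.mem_ofFn]
      have := I.range_orderEmbOfFin rfl
      rw [← Finset.mem_coe, ← this]
      exact Iff.rfl
    rw [h1]
    rcases hl : List.ofFn idx with _ | ⟨a, l⟩
    · obtain ⟨k, hk⟩ := hIne
      rw [← h2, hl] at hk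
      simp at hk
    · refine (prod_hull_compl_singleton hM hQs hC l a).trans ?_
      -- The product over I is the projection for Iᶜ; the indices outside I can be deleted from Iᶜ,
      -- which leaves P.
      rw [← hfin Iᶜ fun j hj => hInot j (Finset.mem_compl.1 hj)]
      have : {j | j ∉ a :: l} = ((Iᶜ : Finset (Fin n)) : Set (Fin n)) := by
        ext j
        rw [mem_ofPred_eq, ← hl, h2, Finset.mem_coe, Finset.mem_compl]
      rw [this]
  rw [hprod]
  refine ⟨le_antisymm (fun x hx => ?_) (iSup_le fun j => ?_), fun j l => ?_, rfl, ?_⟩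
  -- The supremum of subspaces is their algebraic sum, so the inclusion of the complement of Q rests
  -- on the finite telescoping decomposition of x.
  · have h0 : Q.toSubmodule.starProjection x = 0 :=
      (Submodule.starProjection_apply_eq_zero_iff _).2 hx
    rw [← hprod] at h0
    have := sub_prod_apply_mem
      (R := ⨆ j, (hull mulCoord Q.toSubmodule {idx j}ᶜ)ᗮ)
      (l := List.ofFn fun j => p {idx j}ᶜ) (fun A hA y => ?_) x
    · rwa [h0, sub_zero] at this
    · obtain ⟨j, rfl⟩ := List.mem_ofFn.1 hA
      exact Submodule.mem_iSup_of_mem j (Submodule.sub_starProjection_mem_orthogonal y)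
  · exact Submodule.orthogonal_le (le_hull _)
  · rw [commute_iff_eq, hmul, hmul, inter_comm]
  · exact Submodule.starProjection_orthogonal' _
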